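/- Let $a,m\in\mathbb R$. For $V_0,V_1\in C_c^\infty(\mathbb R\setminus\{0\})$ and $J=[0,\infty)$ or $J=[0,T)$, a solution on $J$ of the joint field–particle problem is a pair $u:J\times\mathbb R\to\mathbb R$, $q:J\to\mathbb R$ such that * $\partial_t^2u-\partial_s^2u=a\,\delta(s-q(t))$ in the sense of distributions on $\mathrm{int}(J)\times\mathbb R$, with $u(0,s)=-\frac a2|s|+V_0(s)$ and $\partial_tu(0,s)=V_1(s)$ for all $s\in\mathbb R$; * $q(0)=0$, $\dot q(0)=0$, and there is a function $p$ (the momentum) with $\dot q=\dfrac{p}{m\sqrt{1+p^2/m^2}}$ and $\dot p=f$ on $J$; * the force $f$ is the continuous function on $J$ given by the momentum balance $\partial_t\pi-\partial_s\tau=f(t)\,\delta(s-q(t))$ in the sense of distributions on $\mathrm{int}(J)\times\mathbb R$, where $\pi=u_su_t$ and $\tau=\frac12(u_s^2+u_t^2)$ are locally integrable. **Theorem.** (a) Suppose $m>0$. For all $V_0,V_1\in C_c^\infty(\mathbb R\setminus\{0\})$ there is a solution $(u,q)$ on $[0,\infty)$ such that (i) $u$ is Lipschitz on $[0,\infty)\times\mathbb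 R$ and $q$ is $C^1$ on $[0,\infty)$; (ii) $u$ is $C^1$ on $\{(t,s): t\ge 0,\ s\ne q(t)\}$; (iii) for every $\epsilon>0$ there is $T>0$ such that $|\dot q(t)|<\epsilon$ for all $t>T$. (b) Suppose $m<0$ and $a\neq0$. For every $\epsilon>0$ there are $V_0,V_1\in C_c^\infty(\mathbb R\setminus\{0\})$ with $\|V_0\|_{C^1(\mathbb R)}+\|V_1\|_{C^0(\mathbb R)}<\epsilon$, where $\|V\|_{C^0}=\sup|V|$ and $\|V\|_{C^1}=\sup|V|+\sup|V'|$, a time $T>0$, a continuous function $u$ on $[0,T]\times\mathbb R$ and a function $q$ on $[0,T]$ such that $(u,q)$ restricts to a solution on $[0,T)$ and (i) $u$ is Lipschitz on $[0,T']\times\mathbb R$ for every $T'<T$, and $q$ is $C^1$ on $[0,T]$; (ii) $u$ is $C^1$ on $\{(t,s): 0\le t\le T,\ s\ne q(t)\}$; (iii) the particle reaches the speed of light at time $T$: $|\dot q(T)|=1$. -/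

import Mathlib

open Set MeasureTheory
open scoped ENNReal ContDiff

noncomputable section

/-- Time derivative of a function of the space-time point `z = (t, s)`. -/
def partialTime (g : ℝ × ℝ → ℝ) (z : ℝ × ℝ) : ℝ := deriv (fun t => g (t, z.2)) z.1

/-- Space derivative of a function of the space-time point `z = (t, s)`. -/
def partialSpace (g : ℝ × ℝ → ℝ) (z : ℝ × ℝ) : ℝ := deriv (fun s => g (z.1, s)) z.2

/-- Field momentum density `π = u_s u_t`. -/
def momentumDensity (u : ℝ × ℝ → ℝ) (z : ℝ × ℝ) : ℝ := partialSpace u z * partialTime u z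

/-- Field stress `τ = (u_s² + u_t²) / 2`. -/
def fieldStress (u : ℝ × ℝ → ℝ) (z : ℝ × ℝ) : ℝ :=
  (partialSpace u z ^ 2 + partialTime u z ^ 2) / 2

/-- Test functions on the open space-time region `interior J × ℝ`, where `J` is a time interval. -/
structure IsTestFunction (J : Set ℝ) (φ : ℝ × ℝ → ℝ) : Prop where
  smooth : ContDiff ℝ ∞ φ
  compact_support : HasCompactSupport φ
  support_subset : tsupport φ ⊆ interior J ×ˢ univ

/-- `∂ₜ² u - ∂ₛ² u = a δ(s - q(t))` as distributions on `interior J × ℝ`. -/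
structure IsSourcedWave (a : ℝ) (J : Set ℝ) (u : ℝ × ℝ → ℝ) (q : ℝ → ℝ) : Prop where
  locally_integrable : LocallyIntegrableOn u (interior J ×ˢ univ)
  weak_equation : ∀ φ : ℝ × ℝ → ℝ, IsTestFunction J φ →
    ∫ z, u z * (partialTime (partialTime φ) z - partialSpace (partialSpace φ) z)
      = a * ∫ t, φ (t, q t)

/-- Momentum balance: `π` and `τ` are locally integrable and, as distributions on
`interior J × ℝ`, `∂ₜ π - ∂ₛ τ = f(t) δ(s - q(t))`. A continuous `f` is determined by this. -/
structure IsKiesslingForce (J : Set ℝ) (u : ℝ × ℝ → ℝ) (q f : ℝ → ℝ) : Prop where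
  momentum_integrable : LocallyIntegrableOn (momentumDensity u) (interior J ×ˢ univ)
  stress_integrable : LocallyIntegrableOn (fieldStress u) (interior J ×ˢ univ)
  continuous_force : ContinuousOn f J
  momentum_balance : ∀ φ : ℝ × ℝ → ℝ, IsTestFunction J φ →
    ∫ z, (fieldStress u z * partialSpace φ z - momentumDensity u z * partialTime φ z)
      = ∫ t, f t * φ (t, q t)

/-- `(u, q)` solves the joint field-particle evolution problem with charge `a`, bare mass `m` and
radiation data `(V₀, V₁)` on the time interval `J`, which is `[0, ∞)` or `[0, T)`. -/
structure IsJointSolution (a m : ℝ) (V₀ V₁ : ℝ → ℝ) (J : Set ℝ)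
    (u : ℝ × ℝ → ℝ) (q : ℝ → ℝ) : Prop where
  wave : IsSourcedWave a J u q
  field_initial : ∀ s, u (0, s) = -(a / 2) * |s| + V₀ s
  field_velocity_initial : ∀ s, HasDerivWithinAt (fun t => u (t, s)) (V₁ s) J 0
  motion : ∃ p f : ℝ → ℝ, IsKiesslingForce J u q f ∧
    (∀ t ∈ J, HasDerivWithinAt q (p t / (m * √(1 + p t ^ 2 / m ^ 2))) J t) ∧
    (∀ t ∈ J, HasDerivWithinAt p (f t) J t)
  position_initial : q 0 = 0
  velocity_initial : HasDerivWithinAt q 0 J 0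

/-- Membership in `C_c^∞(ℝ \ {0})`. -/
structure IsRadiationDatum (V : ℝ → ℝ) : Prop where
  smooth : ContDiff ℝ ∞ V
  compact_support : HasCompactSupport V
  away_from_origin : (0 : ℝ) ∉ tsupport V

/-- The `C⁰(ℝ)` norm. -/
def normC0 (V : ℝ → ℝ) : ℝ≥0∞ := ⨆ x, ‖V x‖ₑ

/-- The `C¹(ℝ)` norm. -/
def normC1 (V : ℝ → ℝ) : ℝ≥0∞ := normC0 V + normC0 (deriv V)

end

/-! Away from the particle the field is free, so it is transported along characteristics. The
solution is `jointField`: the d'Alembert radiation part `x (t - s) + y (t + s)` plus `a / 2 * (R -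
t)`, where `R` is the time at which the outgoing characteristic through `(t, s)` left the
trajectory. `R` is an inverse of `t - q t` on the right of the particle and of `t + q t` on its
left.

Both distributional identities rest on one computation. A function of one null coordinate,
multiplied by the derivative of a test function along the matching characteristic and integrated
over one side of the trajectory, collapses to a line integral along the trajectory
(`IsWorldline.integral_right_charDeriv`, `IsWorldline.integral_left_charDeriv`). The wave operator
factors into two characteristic derivatives, which gives the sourced wave equation
(`IsWorldline.isSourcedWave_jointField`). Stress and momentum combine into squares of null
derivatives of the field, which gives the force `a * (y' (t + q) - x' (t - q)) - a ^ 2 / 2 * (v / (1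
- v ^ 2))` (`IsWorldline.momentum_balance_jointField`). The force is thus an explicit function of
time, position and velocity.

Writing `p = m * tan θ`, so that the velocity is `sin θ`, removes the singularity at the speed of
light: `θ' = (a / m) * F * cos θ ^ 2 - (a ^ 2 / (2 * m)) * sin θ`, where `F` is the radiation drive.
This field is bounded and globally Lipschitz, so motions exist for all time
(`exists_isDrivenMotion`), and `isJointSolution_jointField` turns them into joint solutions as long
as `cos θ > 0`.

The sign of `m` decides the rest. For `m > 0` the self-force damps: `θ` stays in a compact part of
`(-π/2, π/2)`, the particle eventually leaves the compactly supported radiation behind, and then `θ`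
decays to `0` (`exists_angle_bound_and_tendsto`). For `m < 0` it amplifies: an arbitrarily small
pulse of the right sign makes `θ` positive, after which it grows until it reaches `π / 2`
(`IsDrivenMotion.exists_angle_eq_pi_div_two`). -/

noncomputable section

/-! ### Characteristic derivatives of test functions. -/

/-- Derivative along the characteristic direction `(1, ε)`. -/
def charDeriv (ε : ℝ) (φ : ℝ × ℝ → ℝ) (z : ℝ × ℝ) : ℝ := partialTime φ z + ε * partialSpace φ z

theorem hasDerivAt_time {φ : ℝ × ℝ → ℝ} {z : ℝ × ℝ} (h : DifferentiableAt ℝ φ z) :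
    HasDerivAt (fun t => φ (t, z.2)) (fderiv ℝ φ z (1, 0)) z.1 := by
  have h1 : HasDerivAt (fun t : ℝ => (t, z.2)) ((1 : ℝ), (0 : ℝ)) z.1 :=
    (hasDerivAt_id z.1).prodMk (hasDerivAt_const z.1 z.2)
  exact HasFDerivAt.comp_hasDerivAt (f := fun t : ℝ => (t, z.2)) z.1 h.hasFDerivAt h1

theorem hasDerivAt_space {φ : ℝ × ℝ → ℝ} {z : ℝ × ℝ} (h : DifferentiableAt ℝ φ z) :
    HasDerivAt (fun s => φ (z.1, s)) (fderiv ℝ φ z (0, 1)) z.2 := by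
  have h1 : HasDerivAt (fun s : ℝ => (z.1, s)) ((0 : ℝ), (1 : ℝ)) z.2 :=
    (hasDerivAt_const z.2 z.1).prodMk (hasDerivAt_id z.2)
  exact HasFDerivAt.comp_hasDerivAt (f := fun s : ℝ => (z.1, s)) z.2 h.hasFDerivAt h1

theorem partialTime_eq_fderiv {φ : ℝ × ℝ → ℝ} (h : Differentiable ℝ φ) :
    partialTime φ = fun z => fderiv ℝ φ z (1, 0) :=
  funext fun z => (hasDerivAt_time (h z)).deriv

theorem partialSpace_eq_fderiv {φ : ℝ × ℝ → ℝ} (h : Differentiable ℝ φ) :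
    partialSpace φ = fun z => fderiv ℝ φ z (0, 1) :=
  funext fun z => (hasDerivAt_space (h z)).deriv

theorem charDeriv_eq_fderiv {φ : ℝ × ℝ → ℝ} (h : Differentiable ℝ φ) (ε : ℝ) :
    charDeriv ε φ = fun z => fderiv ℝ φ z (1, ε) := by
  funext z
  have h2 : ((1 : ℝ), ε) = (1, 0) + ε • ((0 : ℝ), (1 : ℝ)) := by simp
  rw [charDeriv, partialTime_eq_fderiv h, partialSpace_eq_fderiv h, h2, map_add, map_smul]
  simp

theorem contDiff_charDeriv {φ : ℝ × ℝ → ℝ} (h : ContDiff ℝ ∞ φ) (ε : ℝ) :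
    ContDiff ℝ ∞ (charDeriv ε φ) := by
  rw [charDeriv_eq_fderiv (h.differentiable (by simp))]
  exact (h.fderiv_right (by simp)).clm_apply contDiff_const

theorem continuous_charDeriv {φ : ℝ × ℝ → ℝ} (h : ContDiff ℝ 1 φ) (ε : ℝ) :
    Continuous (charDeriv ε φ) := by
  rw [charDeriv_eq_fderiv (h.differentiable (by simp))]
  exact (h.continuous_fderiv (by simp)).clm_apply continuous_const

theorem tsupport_charDeriv_subset {φ : ℝ × ℝ → ℝ} (h : ContDiff ℝ 1 φ) (ε : ℝ) :
    tsupport (charDeriv ε φ) ⊆ tsupport φ := by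
  rw [charDeriv_eq_fderiv (h.differentiable (by simp))]
  exact tsupport_fderiv_apply_subset ℝ _

theorem IsTestFunction.charDeriv {J : Set ℝ} {φ : ℝ × ℝ → ℝ} (h : IsTestFunction J φ) (ε : ℝ) :
    IsTestFunction J (charDeriv ε φ) where
  smooth := contDiff_charDeriv h.smooth ε
  compact_support := h.compact_support.of_isClosed_subset (isClosed_tsupport _)
    (tsupport_charDeriv_subset (h.smooth.of_le (by simp)) ε)
  support_subset := (tsupport_charDeriv_subset (h.smooth.of_le (by simp)) ε).trans h.support_subset

/-- The mixed terms cancel by symmetry of the second derivative. Either factor may come last, so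
each part of the field can be paired with the derivative along its own characteristics. -/
theorem charDeriv_charDeriv_neg {φ : ℝ × ℝ → ℝ} (h : ContDiff ℝ ∞ φ) {ε : ℝ} (hε : ε ^ 2 = 1)
    (z : ℝ × ℝ) : charDeriv ε (charDeriv (-ε) φ) z =
      partialTime (partialTime φ) z - partialSpace (partialSpace φ) z := by
  have hd : Differentiable ℝ φ := h.differentiable (by simp)
  have hf : ContDiff ℝ ∞ (fderiv ℝ φ) := h.fderiv_right (by simp)
  have hfd : Differentiable ℝ (fderiv ℝ φ) := hf.differentiable (by simp)
  have hdir : ∀ v : ℝ × ℝ, Differentiable ℝ (fun z => fderiv ℝ φ z v) := fun v =>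
    hfd.clm_apply (differentiable_const v)
  have key : ∀ v w : ℝ × ℝ, fderiv ℝ (fun z => fderiv ℝ φ z v) z w
      = fderiv ℝ (fderiv ℝ φ) z w v := by
    intro v w
    rw [fderiv_clm_apply (hfd z) (differentiableAt_const v)]
    simp
  have hsym : fderiv ℝ (fderiv ℝ φ) z (1, 0) (0, 1) = fderiv ℝ (fderiv ℝ φ) z (0, 1) (1, 0) :=
    (h.contDiffAt.isSymmSndFDerivAt (by simpa using WithTop.coe_le_coe.2 (le_top : (2 : ℕ∞) ≤ ⊤))) _ _
  rw [charDeriv_eq_fderiv hd, charDeriv_eq_fderiv (hdir _), partialTime_eq_fderiv hd,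
    partialSpace_eq_fderiv hd, partialTime_eq_fderiv (hdir _), partialSpace_eq_fderiv (hdir _)]
  simp only [key]
  have h1 : ((1 : ℝ), ε) = (1, 0) + ε • ((0 : ℝ), (1 : ℝ)) := by simp
  have h2 : ((1 : ℝ), -ε) = (1, 0) + (-ε) • ((0 : ℝ), (1 : ℝ)) := by simp
  rw [h1, h2]
  simp only [map_add, map_smul, add_apply, smul_apply, smul_eq_mul, hsym]
  linear_combination (-(fderiv ℝ (fderiv ℝ φ) z (0, 1) (0, 1))) * hε

/-! ### Integration along characteristics. -/

theorem measurePreserving_shear (ε : ℝ) :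
    MeasurePreserving (fun z : ℝ × ℝ => (z.1, ε * z.1 + z.2)) volume volume :=
  (MeasurePreserving.id volume).skew_product (g := fun t σ => ε * t + σ)
    (by fun_prop) (ae_of_all _ fun t => (measurePreserving_add_left volume (ε * t)).map_eq)

theorem integral_eq_integral_integral_shear (ε : ℝ) {g : ℝ × ℝ → ℝ} (hg : Integrable g) :
    ∫ z, g z = ∫ σ, ∫ t, g (t, ε * t + σ) := by
  have hi := (measurePreserving_shear ε).integrable_comp_of_integrable hg
  rw [integral_integral_swap (f := fun σ t => g (t, ε * t + σ)) hi.swap]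
  rw [← integral_prod (f := fun z : ℝ × ℝ => g (z.1, ε * z.1 + z.2)) hi]
  rw [← Measure.volume_eq_prod]
  nth_rewrite 1 [← (measurePreserving_shear ε).map_eq]
  refine integral_map (measurePreserving_shear ε).measurable.aemeasurable ?_
  rw [(measurePreserving_shear ε).map_eq]
  exact hg.aestronglyMeasurable

theorem integrable_mul_charDeriv {φ : ℝ × ℝ → ℝ} (hφ : ContDiff ℝ 1 φ) (hc : HasCompactSupport φ)
    (ε : ℝ) {X : ℝ × ℝ → ℝ} (hX : Continuous X) :
    Integrable fun z : ℝ × ℝ => X z * charDeriv ε φ z :=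
  (hX.mul (continuous_charDeriv hφ ε)).integrable_of_hasCompactSupport
    (HasCompactSupport.mul_left (hc.of_isClosed_subset (isClosed_tsupport _)
      (tsupport_charDeriv_subset hφ ε)))

theorem hasCompactSupport_comp_shear {φ : ℝ × ℝ → ℝ} (hc : HasCompactSupport φ) (g : ℝ → ℝ) :
    HasCompactSupport fun t => φ (t, g t) :=
  HasCompactSupport.intro (hc.isCompact.image continuous_fst) fun t ht => by
    by_contra h
    exact ht ⟨(t, g t), subset_tsupport _ h, rfl⟩

theorem deriv_comp_shear {φ : ℝ × ℝ → ℝ} (hφ : ContDiff ℝ 1 φ) (ε σ t : ℝ) :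
    deriv (fun t => φ (t, ε * t + σ)) t = charDeriv ε φ (t, ε * t + σ) := by
  have hd : Differentiable ℝ φ := hφ.differentiable (by simp)
  have h1 : HasDerivAt (fun t : ℝ => (t, ε * t + σ)) ((1 : ℝ), ε) t :=
    (hasDerivAt_id t).prodMk (by simpa using ((hasDerivAt_id t).const_mul ε).add_const σ)
  rw [charDeriv_eq_fderiv hd]
  exact (HasFDerivAt.comp_hasDerivAt (f := fun t : ℝ => (t, ε * t + σ)) t
    (hd _).hasFDerivAt h1).deriv

/-- `t - ε * s` is constant along the direction `(1, ε)`, so on each characteristic the integrand is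
a constant times the derivative of a compactly supported function. -/
theorem integral_mul_charDeriv_eq_zero {ε : ℝ} (hε : ε ^ 2 = 1) {φ : ℝ × ℝ → ℝ}
    (hφ : ContDiff ℝ 1 φ) (hc : HasCompactSupport φ) {X : ℝ → ℝ} (hX : Continuous X) :
    ∫ z : ℝ × ℝ, X (z.1 - ε * z.2) * charDeriv ε φ z = 0 := by
  rw [integral_eq_integral_integral_shear ε
    (integrable_mul_charDeriv hφ hc ε (X := fun z => X (z.1 - ε * z.2)) (by fun_prop))]
  refine integral_eq_zero_of_ae (ae_of_all _ fun σ => ?_)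
  have h1 : ∀ t, X (t - ε * (ε * t + σ)) * charDeriv ε φ (t, ε * t + σ)
      = X (-(ε * σ)) * deriv (fun t => φ (t, ε * t + σ)) t := by
    intro t
    rw [deriv_comp_shear hφ]
    congr 2
    linear_combination -t * hε
  have hcs : ContDiff ℝ 1 fun t => φ (t, ε * t + σ) := by fun_prop
  have hcc := hasCompactSupport_comp_shear hc (fun t => ε * t + σ)
  simp only [h1, integral_const_mul]
  rw [integral_eq_zero_of_hasDerivAt_of_integrable
    (fun t => (hcs.differentiable (by simp) t).hasDerivAt)
    ((hcs.continuous_deriv (by simp)).integrable_of_hasCompactSupport hcc.deriv)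
    (hcs.continuous.integrable_of_hasCompactSupport hcc)]
  simp

theorem integrable_indicator_mul_charDeriv {φ : ℝ × ℝ → ℝ} (hφ : ContDiff ℝ 1 φ)
    (hc : HasCompactSupport φ) (ε : ℝ) {X : ℝ × ℝ → ℝ} (hX : Continuous X) {q : ℝ → ℝ}
    (hq : Continuous q) :
    Integrable ({z : ℝ × ℝ | 0 < ε * (z.2 - q z.1)}.indicator fun z => X z * charDeriv ε φ z) :=
  (integrable_mul_charDeriv hφ hc ε hX).indicator
    (isOpen_lt continuous_const (by fun_prop)).measurableSet

/-- By `hR`, the characteristic with null coordinate `ξ` lies on the chosen side exactly after time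
`R ξ`. The fundamental theorem of calculus on that half-line leaves only the value of the test
function at the crossing point. -/
theorem integral_indicator_charDeriv {ε : ℝ} (hε : ε ^ 2 = 1) {φ : ℝ × ℝ → ℝ}
    (hφ : ContDiff ℝ 1 φ) (hc : HasCompactSupport φ) {X R : ℝ → ℝ} (hX : Continuous X)
    {q : ℝ → ℝ} (hq : Continuous q) (hR : ∀ t ξ, R ξ < t ↔ ξ < t - ε * q t) :
    ∫ z, {z : ℝ × ℝ | 0 < ε * (z.2 - q z.1)}.indicator
      (fun z => X (z.1 - ε * z.2) * charDeriv ε φ z) z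
      = -∫ ξ, X ξ * φ (R ξ, ε * (R ξ - ξ)) := by
  rw [integral_eq_integral_integral_shear ε (integrable_indicator_mul_charDeriv hφ hc ε
    (X := fun z => X (z.1 - ε * z.2)) (by fun_prop) hq)]
  have inner : ∀ σ : ℝ, (∫ t, {z : ℝ × ℝ | 0 < ε * (z.2 - q z.1)}.indicator
      (fun z => X (z.1 - ε * z.2) * charDeriv ε φ z) (t, ε * t + σ))
      = (fun ξ => -(X ξ * φ (R ξ, ε * (R ξ - ξ)))) (-(ε * σ)) := by
    intro σ
    have h1 : ∀ t, {z : ℝ × ℝ | 0 < ε * (z.2 - q z.1)}.indicator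
        (fun z => X (z.1 - ε * z.2) * charDeriv ε φ z) (t, ε * t + σ)
        = (Ioi (R (-(ε * σ)))).indicator
          (fun t => X (-(ε * σ)) * deriv (fun t => φ (t, ε * t + σ)) t) t := by
      intro t
      have hiff : 0 < ε * (ε * t + σ - q t) ↔ R (-(ε * σ)) < t := by
        rw [hR, ← sub_pos (a := t - ε * q t)]
        have : ε * (ε * t + σ - q t) = t - ε * q t - -(ε * σ) := by linear_combination t * hε
        rw [this]
      by_cases hlt : R (-(ε * σ)) < t
      · rw [indicator_of_mem (show (t, ε * t + σ) ∈ {z : ℝ × ℝ | 0 < ε * (z.2 - q z.1)} from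
          hiff.2 hlt), indicator_of_mem (show t ∈ Ioi _ from hlt), deriv_comp_shear hφ]
        congr 2
        linear_combination -t * hε
      · rw [indicator_of_notMem (show (t, ε * t + σ) ∉ {z : ℝ × ℝ | 0 < ε * (z.2 - q z.1)} from
          fun h => hlt (hiff.1 h)), indicator_of_notMem (show t ∉ Ioi _ from hlt)]
    simp only [h1]
    rw [integral_indicator measurableSet_Ioi, integral_const_mul,
      (hasCompactSupport_comp_shear hc _).integral_Ioi_deriv_eq (by fun_prop)]
    have : ε * R (-(ε * σ)) + σ = ε * (R (-(ε * σ)) - -(ε * σ)) := by linear_combination -σ * hε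
    rw [this]
    ring
  simp only [inner]
  -- The inner integral depends on `-(ε * σ)`; for `ε = 1` the reflection of the line brings it to
  -- `ξ`.
  rcases sq_eq_one_iff.1 hε with rfl | rfl
  · simp only [one_mul]
    rw [integral_neg_eq_self (fun ξ => -(X ξ * φ (R ξ, (R ξ - ξ)))), integral_neg]
  · simp only [neg_mul, one_mul, neg_neg]
    rw [integral_neg]

/-- Change of variables along the trajectory. -/
theorem integral_comp_retarded {ε : ℝ} (hε : ε ^ 2 = 1) {I : Set ℝ} (hI : IsOpen I)
    {φ : ℝ × ℝ → ℝ} (hφ : ∀ z, z.1 ∉ I → φ z = 0) (X : ℝ → ℝ) {R q v : ℝ → ℝ}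
    (hR : ∀ t, R (t - ε * q t) = t) (hR' : ∀ ξ, R ξ - ε * q (R ξ) = ξ)
    (hv : ∀ t ∈ I, HasDerivAt q (v t) t) (hsub : ∀ t ∈ I, ε * v t < 1) :
    ∫ ξ, X ξ * φ (R ξ, ε * (R ξ - ξ)) = ∫ t, (1 - ε * v t) * X (t - ε * q t) * φ (t, q t) := by
  have h1 : ∀ ξ, ξ ∉ (fun t => t - ε * q t) '' I → X ξ * φ (R ξ, ε * (R ξ - ξ)) = 0 := by
    intro ξ hξ
    rw [hφ, mul_zero]
    exact fun h => hξ ⟨R ξ, h, hR' ξ⟩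
  have h2 : ∀ t, t ∉ I → (1 - ε * v t) * X (t - ε * q t) * φ (t, q t) = 0 := by
    intro t ht
    rw [hφ (t, q t) ht, mul_zero]
  rw [← setIntegral_eq_integral_of_forall_compl_eq_zero h1,
    ← setIntegral_eq_integral_of_forall_compl_eq_zero h2,
    integral_image_eq_integral_abs_deriv_smul (f := fun t => t - ε * q t) (f' := fun t => 1 - ε * v t) hI.measurableSet
      (fun t ht => ((hasDerivAt_id t).sub ((hv t ht).const_mul ε)).hasDerivWithinAt)
      (fun t _ t' _ h => by rw [← hR t, ← hR t']; exact congrArg R h)]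
  refine setIntegral_congr_fun hI.measurableSet fun t ht => ?_
  have : ε * (t - (t - ε * q t)) = q t := by linear_combination q t * hε
  simp only [hR, this, smul_eq_mul]
  rw [abs_of_pos (by linarith [hsub t ht])]
  ring

/-! ### Worldlines and retarded times. -/

/-- A trajectory `q` which rests at the origin until time `0`, has continuous subluminal velocity `v`
on the time interval `I` (unbounded to the left), and whose null coordinates `t ∓ q t` are global
coordinates on the trajectory. -/
structure IsWorldline (I : Set ℝ) (q v : ℝ → ℝ) : Prop where
  isOpen : IsOpen I
  mem_of_le : ∀ t ∈ I, ∀ t' ≤ t, t' ∈ I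
  zero_mem : 0 ∈ I
  hasDerivAt : ∀ t ∈ I, HasDerivAt q (v t) t
  continuous_velocity : Continuous v
  subluminal : ∀ t ∈ I, |v t| < 1
  continuous : Continuous q
  eq_zero : ∀ t ≤ 0, q t = 0
  strictMono_sub : StrictMono fun t => t - q t
  strictMono_add : StrictMono fun t => t + q t
  tendsto_sub : Filter.Tendsto (fun t => t - q t) Filter.atTop Filter.atTop
  tendsto_add : Filter.Tendsto (fun t => t + q t) Filter.atTop Filter.atTop

/-- The time at which the trajectory `q` has null coordinate `t - q t` equal to `ξ`. -/
def retardedTime (q : ℝ → ℝ) : ℝ → ℝ := Function.invFun fun t => t - q t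

namespace IsWorldline

variable {I : Set ℝ} {q v : ℝ → ℝ}

/-- Space reflection: every statement about `t - q t` and the right side yields one about `t + q t`
and the left side. -/
theorem neg (h : IsWorldline I q v) : IsWorldline I (fun t => -q t) (fun t => -v t) where
  isOpen := h.isOpen
  mem_of_le := h.mem_of_le
  zero_mem := h.zero_mem
  hasDerivAt t ht := (h.hasDerivAt t ht).neg
  continuous_velocity := h.continuous_velocity.neg
  subluminal t ht := by rw [abs_neg]; exact h.subluminal t ht
  continuous := h.continuous.neg
  eq_zero t ht := by rw [h.eq_zero t ht, neg_zero]
  strictMono_sub := by simpa using h.strictMono_add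
  strictMono_add := by simpa [← sub_eq_add_neg] using h.strictMono_sub
  tendsto_sub := by simpa using h.tendsto_add
  tendsto_add := by simpa [← sub_eq_add_neg] using h.tendsto_sub

theorem surjective_sub (h : IsWorldline I q v) : Function.Surjective fun t => t - q t := by
  refine (continuous_id.sub h.continuous).surjective h.tendsto_sub ?_
  refine Filter.tendsto_id.congr' ?_
  filter_upwards [Filter.eventually_le_atBot (0 : ℝ)] with t ht
  simp [h.eq_zero t ht]

theorem retardedTime_sub (h : IsWorldline I q v) (t : ℝ) : retardedTime q (t - q t) = t :=
  Function.leftInverse_invFun h.strictMono_sub.injective t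

theorem sub_retardedTime (h : IsWorldline I q v) (ξ : ℝ) :
    retardedTime q ξ - q (retardedTime q ξ) = ξ :=
  Function.rightInverse_invFun h.surjective_sub ξ

theorem retardedTime_lt_iff (h : IsWorldline I q v) {t ξ : ℝ} :
    retardedTime q ξ < t ↔ ξ < t - q t := by
  conv_rhs => rw [← h.sub_retardedTime ξ]
  exact (h.strictMono_sub.lt_iff_lt (a := retardedTime q ξ) (b := t)).symm

theorem le_retardedTime_iff (h : IsWorldline I q v) {t ξ : ℝ} :
    t ≤ retardedTime q ξ ↔ t - q t ≤ ξ := by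
  rw [← not_lt, h.retardedTime_lt_iff, not_lt]

theorem monotone_retardedTime (h : IsWorldline I q v) : Monotone (retardedTime q) := by
  intro ξ ξ' hle
  rw [h.le_retardedTime_iff, h.sub_retardedTime]
  exact hle

theorem continuous_retardedTime (h : IsWorldline I q v) : Continuous (retardedTime q) :=
  h.monotone_retardedTime.continuous_of_surjective fun t => ⟨_, h.retardedTime_sub t⟩

theorem retardedTime_of_nonpos (h : IsWorldline I q v) {ξ : ℝ} (hξ : ξ ≤ 0) :
    retardedTime q ξ = ξ := by
  have := h.retardedTime_sub ξ
  rwa [h.eq_zero ξ hξ, sub_zero] at this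

theorem velocity_eq_zero (h : IsWorldline I q v) {t : ℝ} (ht : t ≤ 0) : v t = 0 := by
  have h1 : HasDerivWithinAt q (v t) (Iic t) t :=
    (h.hasDerivAt t (h.mem_of_le 0 h.zero_mem t ht)).hasDerivWithinAt
  have h2 : HasDerivWithinAt q 0 (Iic t) t :=
    (hasDerivWithinAt_const t (Iic t) (0 : ℝ)).congr (fun t' ht' => h.eq_zero t' (ht'.trans ht))
      (h.eq_zero t ht)
  exact (uniqueDiffOn_Iic t t self_mem_Iic).eq_deriv _ h1 h2

/-- Before time `0` the velocity vanishes, so only a compact time interval matters, on which the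
speed attains a maximum below `1`. -/
theorem exists_velocity_bound (h : IsWorldline I q v) {T : ℝ} (hT : T ∈ I) :
    ∃ κ < 1, ∀ t ≤ T, |v t| ≤ κ := by
  have hT' : max T 0 ∈ I := by
    rcases max_choice T 0 with h' | h' <;> rw [h']
    exacts [hT, h.zero_mem]
  obtain ⟨t₀, ht₀, hmax⟩ := (isCompact_Icc (a := (0 : ℝ)) (b := max T 0)).exists_isMaxOn
    ⟨0, by simp⟩ h.continuous_velocity.abs.continuousOn
  refine ⟨|v t₀|, h.subluminal t₀ (h.mem_of_le _ hT' t₀ ht₀.2), fun t ht => ?_⟩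
  rcases le_total t 0 with h0 | h0
  · rw [h.velocity_eq_zero h0, abs_zero]
    exact abs_nonneg _
  · exact hmax ⟨h0, ht.trans (le_max_left _ _)⟩

theorem velocity_lt_one (h : IsWorldline I q v) {t : ℝ} (ht : t ∈ I) : v t < 1 :=
  (abs_lt.1 (h.subluminal t ht)).2

theorem hasDerivAt_retardedTime (h : IsWorldline I q v) {ξ : ℝ} (hξ : retardedTime q ξ ∈ I) :
    HasDerivAt (retardedTime q) (1 / (1 - v (retardedTime q ξ))) ξ := by
  rw [one_div]
  refine HasDerivAt.of_local_left_inverse (f := fun t => t - q t)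
    h.continuous_retardedTime.continuousAt
    ((hasDerivAt_id _).sub (h.hasDerivAt _ hξ)) (by linarith [h.velocity_lt_one hξ])
    (Filter.Eventually.of_forall h.sub_retardedTime)

theorem contDiffAt_retardedTime (h : IsWorldline I q v) {ξ : ℝ} (hξ : retardedTime q ξ ∈ I) :
    ContDiffAt ℝ 1 (retardedTime q) ξ := by
  have hopen : IsOpen (retardedTime q ⁻¹' I) := h.isOpen.preimage h.continuous_retardedTime
  refine ContDiffOn.contDiffAt (s := retardedTime q ⁻¹' I) ?_ (hopen.mem_nhds hξ)
  rw [show (1 : WithTop ℕ∞) = 0 + 1 from rfl, contDiffOn_succ_iff_deriv_of_isOpen hopen]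
  refine ⟨fun x hx => (h.hasDerivAt_retardedTime hx).differentiableAt.differentiableWithinAt,
    by simp, ?_⟩
  rw [contDiffOn_zero]
  have hc : ContinuousOn (fun x => 1 / (1 - v (retardedTime q x))) (retardedTime q ⁻¹' I) :=
    continuousOn_const.div (continuous_const.sub
      (h.continuous_velocity.comp h.continuous_retardedTime)).continuousOn
      fun x hx => by linarith [h.velocity_lt_one hx]
  exact hc.congr fun x hx => (h.hasDerivAt_retardedTime hx).deriv

theorem mul_sub_le (h : IsWorldline I q v) {κ T : ℝ} (hT : T ∈ I) (hκ : ∀ t ≤ T, v t ≤ κ)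
    {t t' : ℝ} (hle : t ≤ t') (ht' : t' ≤ T) : (1 - κ) * (t' - t) ≤ (t' - q t') - (t - q t) := by
  have hd : ∀ x ∈ Iic T, HasDerivAt (fun t => t - q t) (1 - v x) x := fun x hx =>
    (hasDerivAt_id x).sub (h.hasDerivAt x (h.mem_of_le T hT x hx))
  refine (convex_Iic T).mul_sub_le_image_sub_of_le_deriv
    (continuous_id.sub h.continuous).continuousOn
    (fun x hx => (hd x (interior_subset hx)).differentiableAt.differentiableWithinAt)
    (fun x hx => ?_) t (hle.trans ht') t' ht' hle
  rw [show deriv (id - q) x = 1 - v x from (hd x (interior_subset hx)).deriv]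
  linarith [hκ x (mem_Iic.1 (interior_subset hx))]

/-- Up to time `T` the map `t - q t` has slope at least `1 - κ`, so its inverse has slope at most
`(1 - κ)⁻¹`. The truncation at `T` discards later times, where no speed bound is assumed. -/
theorem abs_min_retardedTime_sub_le (h : IsWorldline I q v) {κ T : ℝ} (hT : T ∈ I)
    (hκ1 : κ < 1) (hκ : ∀ t ≤ T, v t ≤ κ) (ξ ξ' : ℝ) :
    |min (retardedTime q ξ) T - min (retardedTime q ξ') T| ≤ (1 - κ)⁻¹ * |ξ - ξ'| := by
  wlog hle : ξ' ≤ ξ generalizing ξ ξ'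
  · rw [abs_sub_comm, abs_sub_comm ξ]
    exact this ξ' ξ (le_of_not_ge hle)
  have hR := h.monotone_retardedTime hle
  have hmin : min (retardedTime q ξ') T ≤ min (retardedTime q ξ) T := min_le_min_right T hR
  rw [abs_of_nonneg (sub_nonneg.2 hmin), abs_of_nonneg (sub_nonneg.2 hle),
    le_inv_mul_iff₀ (by linarith)]
  refine (h.mul_sub_le hT hκ hmin (min_le_right _ _)).trans ?_
  rcases le_total (retardedTime q ξ') T with h1 | h1
  · rw [min_eq_left h1, h.sub_retardedTime]
    have := h.strictMono_sub.monotone (min_le_left (retardedTime q ξ) T)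
    simp only [h.sub_retardedTime] at this
    linarith
  · rw [min_eq_right h1, min_eq_right (h1.trans hR)]
    linarith

theorem integral_right_charDeriv (h : IsWorldline I q v) {φ : ℝ × ℝ → ℝ} (hφ : ContDiff ℝ 1 φ)
    (hc : HasCompactSupport φ) (hI : ∀ z, z.1 ∉ I → φ z = 0) {X : ℝ → ℝ} (hX : Continuous X) :
    ∫ z, {z : ℝ × ℝ | q z.1 < z.2}.indicator (fun z => X (z.1 - z.2) * charDeriv 1 φ z) z
      = -∫ t, (1 - v t) * X (t - q t) * φ (t, q t) := by
  have h1 := integral_indicator_charDeriv (ε := 1) (by norm_num) hφ hc hX h.continuous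
    (R := retardedTime q) (fun t ξ => by rw [one_mul]; exact h.retardedTime_lt_iff)
  have h2 := integral_comp_retarded (ε := 1) (by norm_num) h.isOpen hI X (R := retardedTime q)
    (by simpa using h.retardedTime_sub) (by simpa using h.sub_retardedTime) h.hasDerivAt
    (fun t ht => by linarith [h.velocity_lt_one ht])
  rw [h2] at h1
  simpa using h1

theorem integral_left_charDeriv (h : IsWorldline I q v) {φ : ℝ × ℝ → ℝ} (hφ : ContDiff ℝ 1 φ)
    (hc : HasCompactSupport φ) (hI : ∀ z, z.1 ∉ I → φ z = 0) {X : ℝ → ℝ} (hX : Continuous X) :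
    ∫ z, {z : ℝ × ℝ | z.2 < q z.1}.indicator (fun z => X (z.1 + z.2) * charDeriv (-1) φ z) z
      = -∫ t, (1 + v t) * X (t + q t) * φ (t, q t) := by
  have hn := h.neg
  have h1 := integral_indicator_charDeriv (ε := -1) (by norm_num) hφ hc hX h.continuous
    (R := retardedTime fun t => -q t) (fun t ξ => by
      rw [neg_one_mul]; exact hn.retardedTime_lt_iff)
  have h2 := integral_comp_retarded (ε := -1) (by norm_num) h.isOpen hI X
    (R := retardedTime fun t => -q t)
    (by simpa using hn.retardedTime_sub) (by simpa using hn.sub_retardedTime) h.hasDerivAt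
    (fun t ht => by linarith [(abs_lt.1 (h.subluminal t ht)).1])
  rw [h2] at h1
  simpa using h1

end IsWorldline

/-! ### The joint field and its regularity. -/

/-- The field of a charge `a` with trajectory `q`, starting from the static field at time `0`,
superposed with the radiation field `x (t - s) + y (t + s)`. -/
def jointField (a : ℝ) (x y q : ℝ → ℝ) (z : ℝ × ℝ) : ℝ :=
  x (z.1 - z.2) + y (z.1 + z.2) + a / 2 *
    (min (retardedTime q (z.1 - z.2)) (retardedTime (fun t => -q t) (z.1 + z.2)) - z.1)

theorem jointField_reflect (a : ℝ) (x y q : ℝ → ℝ) (t s : ℝ) :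
    jointField a y x (fun t => -q t) (t, -s) = jointField a x y q (t, s) := by
  simp only [jointField, sub_neg_eq_add, neg_neg, ← sub_eq_add_neg]
  rw [min_comm, add_comm (y _)]

namespace IsWorldline

variable {I : Set ℝ} {q v : ℝ → ℝ}

/-- To the right of the particle, the right-moving characteristic has already met the trajectory and
the left-moving one has not done so earlier than `t`; the minimum picks the former. -/
theorem min_retardedTime_of_le (h : IsWorldline I q v) {t s : ℝ} (hs : q t ≤ s) :
    min (retardedTime q (t - s)) (retardedTime (fun t => -q t) (t + s))
      = retardedTime q (t - s) := by
  refine min_eq_left (le_trans (b := t) ?_ ?_)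
  · rw [← h.retardedTime_sub t]
    exact h.monotone_retardedTime (by rw [h.retardedTime_sub]; linarith)
  · rw [h.neg.le_retardedTime_iff]
    linarith

theorem min_retardedTime_of_ge (h : IsWorldline I q v) {t s : ℝ} (hs : s ≤ q t) :
    min (retardedTime q (t - s)) (retardedTime (fun t => -q t) (t + s))
      = retardedTime (fun t => -q t) (t + s) := by
  have := h.neg.min_retardedTime_of_le (t := t) (s := -s) (neg_le_neg hs)
  simp only [neg_neg, sub_neg_eq_add, ← sub_eq_add_neg] at this
  rwa [min_comm]

theorem min_retardedTime_le (h : IsWorldline I q v) (t s : ℝ) :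
    min (retardedTime q (t - s)) (retardedTime (fun t => -q t) (t + s)) ≤ t := by
  by_contra! hlt
  obtain ⟨h1, h2⟩ := lt_min_iff.1 hlt
  have h1' := h.le_retardedTime_iff.1 h1.le
  have h2' := h.neg.le_retardedTime_iff.1 h2.le
  have h3 : s = q t := by linarith
  rw [h3, h.retardedTime_sub] at h1
  exact lt_irrefl _ h1

theorem continuous_jointField (h : IsWorldline I q v) (a : ℝ) {x y : ℝ → ℝ} (hx : Continuous x)
    (hy : Continuous y) : Continuous (jointField a x y q) := by
  have h1 := h.continuous_retardedTime
  have h2 := h.neg.continuous_retardedTime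
  unfold jointField
  fun_prop

theorem abs_jointField_sub_le (h : IsWorldline I q v) (a : ℝ) {x y : ℝ → ℝ} {C : ℝ}
    (hx : ∀ ξ ξ', |x ξ - x ξ'| ≤ C * |ξ - ξ'|) (hy : ∀ ξ ξ', |y ξ - y ξ'| ≤ C * |ξ - ξ'|)
    {κ T : ℝ} (hT : T ∈ I) (hκ1 : κ < 1) (hκ : ∀ t ≤ T, |v t| ≤ κ) {z w : ℝ × ℝ}
    (hz : z.1 ≤ T) (hw : w.1 ≤ T) :
    |jointField a x y q z - jointField a x y q w|
      ≤ (4 * C + |a| / 2 * (2 * (1 - κ)⁻¹ + 1)) * dist z w := by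
  obtain ⟨t, s⟩ := z
  obtain ⟨t', s'⟩ := w
  set d := dist (t, s) (t', s') with hd
  have hdt : |t - t'| ≤ d := le_max_left _ _
  have hds : |s - s'| ≤ d := le_max_right _ _
  have hm : |(t - s) - (t' - s')| ≤ 2 * d := by
    rw [show (t - s) - (t' - s') = (t - t') - (s - s') by ring]
    linarith [abs_sub (t - t') (s - s')]
  have hp : |(t + s) - (t' + s')| ≤ 2 * d := by
    rw [show (t + s) - (t' + s') = (t - t') + (s - s') by ring]
    linarith [abs_add_le (t - t') (s - s')]
  have hC : 0 ≤ C := by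
    have := (abs_nonneg _).trans (hx 1 0)
    simpa using this
  have hk : 0 ≤ (1 - κ)⁻¹ := inv_nonneg.2 (by linarith)
  have e1 := (hx (t - s) (t' - s')).trans (mul_le_mul_of_nonneg_left hm hC)
  have e2 := (hy (t + s) (t' + s')).trans (mul_le_mul_of_nonneg_left hp hC)
  -- The retarded time never exceeds `t ≤ T`, so truncating both candidates at `T` changes nothing
  -- and makes each of them Lipschitz.
  have hmin : ∀ t s, t ≤ T →
      min (retardedTime q (t - s)) (retardedTime (fun t => -q t) (t + s))
      = min (min (retardedTime q (t - s)) T) (min (retardedTime (fun t => -q t) (t + s)) T) := by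
    intro t s ht
    rw [← inf_inf_distrib_right, min_eq_left ((h.min_retardedTime_le t s).trans ht)]
  have e3 : |min (retardedTime q (t - s)) (retardedTime (fun t => -q t) (t + s))
      - min (retardedTime q (t' - s')) (retardedTime (fun t => -q t) (t' + s'))|
      ≤ (1 - κ)⁻¹ * (2 * d) := by
    rw [hmin t s hz, hmin t' s' hw]
    refine (abs_min_sub_min_le_max _ _ _ _).trans (max_le ?_ ?_)
    · exact (h.abs_min_retardedTime_sub_le hT hκ1 (fun t ht => (abs_le.1 (hκ t ht)).2) _ _).trans
        (mul_le_mul_of_nonneg_left hm hk)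
    · exact (h.neg.abs_min_retardedTime_sub_le hT hκ1
        (fun t ht => by linarith [(abs_le.1 (hκ t ht)).1]) _ _).trans
        (mul_le_mul_of_nonneg_left hp hk)
  have key : jointField a x y q (t, s) - jointField a x y q (t', s')
      = (x (t - s) - x (t' - s')) + (y (t + s) - y (t' + s'))
      + a / 2 * ((min (retardedTime q (t - s)) (retardedTime (fun t => -q t) (t + s))
      - min (retardedTime q (t' - s')) (retardedTime (fun t => -q t) (t' + s'))) - (t - t')) := by
    simp only [jointField]
    ring
  rw [key]
  refine (abs_add_three _ _ _).trans ?_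
  rw [abs_mul, abs_div, abs_two]
  have e4 := mul_le_mul_of_nonneg_left ((abs_sub _ _).trans (add_le_add e3 hdt))
    (show 0 ≤ |a| / 2 by positivity)
  calc _ ≤ C * (2 * d) + C * (2 * d) + |a| / 2 * ((1 - κ)⁻¹ * (2 * d) + d) := by
        gcongr
    _ = _ := by ring

theorem eventually_jointField_right (h : IsWorldline I q v) (a : ℝ) (x y : ℝ → ℝ) {z : ℝ × ℝ}
    (hz : q z.1 < z.2) : jointField a x y q =ᶠ[nhds z] fun z =>
      x (z.1 - z.2) + y (z.1 + z.2) + a / 2 * (retardedTime q (z.1 - z.2) - z.1) := by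
  have hopen : IsOpen {z : ℝ × ℝ | q z.1 < z.2} :=
    isOpen_lt (h.continuous.comp continuous_fst) continuous_snd
  filter_upwards [hopen.mem_nhds hz] with w hw
  simp only [jointField]
  rw [h.min_retardedTime_of_le (le_of_lt hw)]

/-- Off the trajectory the retarded time is strictly earlier than `z.1`, so membership in `I` is
needed only before `z.1`. This gives regularity of the field even at the final time, where the speed
may be `1`. -/
theorem retardedTime_mem (h : IsWorldline I q v) {z : ℝ × ℝ} (hz : q z.1 < z.2)
    (hI : ∀ t < z.1, t ∈ I) : retardedTime q (z.1 - z.2) ∈ I :=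
  hI _ (h.retardedTime_lt_iff.2 (by linarith))

theorem contDiffAt_jointField_right (h : IsWorldline I q v) (a : ℝ) {x y : ℝ → ℝ}
    (hx : ContDiff ℝ 1 x) (hy : ContDiff ℝ 1 y) {z : ℝ × ℝ} (hz : q z.1 < z.2)
    (hI : ∀ t < z.1, t ∈ I) : ContDiffAt ℝ 1 (jointField a x y q) z := by
  refine ContDiffAt.congr_of_eventuallyEq ?_ (h.eventually_jointField_right a x y hz)
  have hR : ContDiffAt ℝ 1 (fun z : ℝ × ℝ => retardedTime q (z.1 - z.2)) z :=
    ContDiffAt.comp z (h.contDiffAt_retardedTime (h.retardedTime_mem hz hI))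
      (contDiffAt_fst.sub contDiffAt_snd)
  have hx' : ContDiff ℝ 1 (fun z : ℝ × ℝ => x (z.1 - z.2)) := by fun_prop
  have hy' : ContDiff ℝ 1 (fun z : ℝ × ℝ => y (z.1 + z.2)) := by fun_prop
  exact (hx'.contDiffAt.add hy'.contDiffAt).add
    (contDiffAt_const.mul (hR.sub contDiffAt_fst))

theorem contDiffAt_jointField (h : IsWorldline I q v) (a : ℝ) {x y : ℝ → ℝ}
    (hx : ContDiff ℝ 1 x) (hy : ContDiff ℝ 1 y) {z : ℝ × ℝ} (hz : z.2 ≠ q z.1)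
    (hI : ∀ t < z.1, t ∈ I) : ContDiffAt ℝ 1 (jointField a x y q) z := by
  rcases lt_or_gt_of_ne hz with hlt | hlt
  · have h1 := h.neg.contDiffAt_jointField_right a hy hx (z := (z.1, -z.2)) (by simpa using hlt) hI
    have h2 : ContDiffAt ℝ 1 (fun z : ℝ × ℝ => (z.1, -z.2)) z :=
      contDiffAt_fst.prodMk contDiffAt_snd.neg
    refine (ContDiffAt.comp z h1 h2).congr_of_eventuallyEq (Filter.Eventually.of_forall fun w => ?_)
    exact (jointField_reflect a x y q w.1 w.2).symm
  · exact h.contDiffAt_jointField_right a hx hy hlt hI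

theorem partial_jointField_right (h : IsWorldline I q v) (a : ℝ) {x y x' y' : ℝ → ℝ}
    (hx : ∀ ξ, HasDerivAt x (x' ξ) ξ) (hy : ∀ ξ, HasDerivAt y (y' ξ) ξ) {z : ℝ × ℝ}
    (hz : q z.1 < z.2) (hI : ∀ t < z.1, t ∈ I) :
    partialTime (jointField a x y q) z = x' (z.1 - z.2) + y' (z.1 + z.2)
      + a / 2 * (1 / (1 - v (retardedTime q (z.1 - z.2))) - 1) ∧
    partialSpace (jointField a x y q) z = -x' (z.1 - z.2) + y' (z.1 + z.2)
      - a / 2 * (1 / (1 - v (retardedTime q (z.1 - z.2)))) := by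
  obtain ⟨t, s⟩ := z
  have hR := h.hasDerivAt_retardedTime (h.retardedTime_mem hz hI)
  have hev := h.eventually_jointField_right a x y hz
  simp only at hR ⊢
  constructor
  · have h1 : (fun t => jointField a x y q (t, s)) =ᶠ[nhds t] fun t =>
        x (t - s) + y (t + s) + a / 2 * (retardedTime q (t - s) - t) :=
      (Continuous.tendsto (f := fun t : ℝ => (t, s)) (by fun_prop) t).eventually hev
    refine (HasDerivAt.congr_of_eventuallyEq ?_ h1).deriv
    have hm : HasDerivAt (fun t => t - s) 1 t := (hasDerivAt_id t).sub_const s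
    have hp : HasDerivAt (fun t => t + s) 1 t := (hasDerivAt_id t).add_const s
    have := (((hx _).comp t hm).add ((hy _).comp t hp)).add
      (((hR.comp t hm).sub (hasDerivAt_id t)).const_mul (a / 2))
    exact this.congr_deriv (by ring)
  · have h1 : (fun s => jointField a x y q (t, s)) =ᶠ[nhds s] fun s =>
        x (t - s) + y (t + s) + a / 2 * (retardedTime q (t - s) - t) :=
      (Continuous.tendsto (f := fun s : ℝ => (t, s)) (by fun_prop) s).eventually hev
    refine (HasDerivAt.congr_of_eventuallyEq ?_ h1).deriv
    have hm : HasDerivAt (fun s => t - s) (-1) s := (hasDerivAt_id s).const_sub t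
    have hp : HasDerivAt (fun s => t + s) 1 s := (hasDerivAt_id s).const_add t
    have := (((hx _).comp s hm).add ((hy _).comp s hp)).add
      (((hR.comp s hm).sub_const t).const_mul (a / 2))
    exact this.congr_deriv (by ring)

theorem partial_jointField_left (h : IsWorldline I q v) (a : ℝ) {x y x' y' : ℝ → ℝ}
    (hx : ∀ ξ, HasDerivAt x (x' ξ) ξ) (hy : ∀ ξ, HasDerivAt y (y' ξ) ξ) {z : ℝ × ℝ}
    (hz : z.2 < q z.1) (hI : ∀ t < z.1, t ∈ I) :
    partialTime (jointField a x y q) z = x' (z.1 - z.2) + y' (z.1 + z.2)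
      + a / 2 * (1 / (1 + v (retardedTime (fun t => -q t) (z.1 + z.2))) - 1) ∧
    partialSpace (jointField a x y q) z = -x' (z.1 - z.2) + y' (z.1 + z.2)
      + a / 2 * (1 / (1 + v (retardedTime (fun t => -q t) (z.1 + z.2)))) := by
  obtain ⟨t, s⟩ := z
  obtain ⟨h1, h2⟩ := h.neg.partial_jointField_right a hy hx (z := (t, -s)) (neg_lt_neg hz) hI
  have e1 : partialTime (jointField a y x fun t => -q t) (t, -s)
      = partialTime (jointField a x y q) (t, s) := by
    simp only [partialTime, jointField_reflect]
  have e2 : partialSpace (jointField a x y q) (t, s)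
      = -partialSpace (jointField a y x fun t => -q t) (t, -s) := by
    simp only [partialSpace, ← jointField_reflect a x y q]
    exact deriv_comp_neg (fun s => jointField a y x (fun t => -q t) (t, s)) s
  simp only [sub_neg_eq_add, ← sub_eq_add_neg] at h1 h2 ⊢
  rw [← e1, e2, h1, h2]
  constructor <;> ring

end IsWorldline

/-! ### The distributional wave equation and momentum balance. -/

theorem ae_snd_ne {q : ℝ → ℝ} (hq : Continuous q) : ∀ᵐ z : ℝ × ℝ, z.2 ≠ q z.1 := by
  have hm : MeasurableSet {z : ℝ × ℝ | ¬ z.2 ≠ q z.1} := by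
    simp only [not_not]
    exact (isClosed_eq continuous_snd (hq.comp continuous_fst)).measurableSet
  rw [ae_iff, Measure.volume_eq_prod, Measure.measure_prod_null hm]
  refine Filter.Eventually.of_forall fun t => ?_
  have : Prod.mk t ⁻¹' {z : ℝ × ℝ | ¬ z.2 ≠ q z.1} = {q t} := by
    ext s
    simp
  simp only [this]
  exact measure_singleton _

theorem integral_add_add_add {α : Type*} [MeasurableSpace α] {μ : Measure α} {A B C D : α → ℝ}
    (hA : Integrable A μ) (hB : Integrable B μ) (hC : Integrable C μ) (hD : Integrable D μ) :
    ∫ z, (A z + B z + (C z + D z)) ∂μ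
      = (∫ z, A z ∂μ) + (∫ z, B z ∂μ) + ((∫ z, C z ∂μ) + ∫ z, D z ∂μ) := by
  rw [← integral_add hA hB, ← integral_add hC hD]
  exact integral_add (hA.add hB) (hC.add hD)

theorem integral_sub_add_sub {α : Type*} [MeasurableSpace α] {μ : Measure α} {A B C D : α → ℝ}
    (hA : Integrable A μ) (hB : Integrable B μ) (hC : Integrable C μ) (hD : Integrable D μ) :
    ∫ z, (A z - B z + (C z - D z)) ∂μ
      = (∫ z, A z ∂μ) - (∫ z, B z ∂μ) + ((∫ z, C z ∂μ) - ∫ z, D z ∂μ) := by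
  rw [← integral_sub hA hB, ← integral_sub hC hD]
  exact integral_add (hA.sub hB) (hC.sub hD)

theorem charDeriv_eq_zero_of_notMem_tsupport {φ : ℝ × ℝ → ℝ} (h : ContDiff ℝ 1 φ) (ε : ℝ)
    {z : ℝ × ℝ} (hz : z ∉ tsupport φ) : charDeriv ε φ z = 0 :=
  image_eq_zero_of_notMem_tsupport fun h' => hz (tsupport_charDeriv_subset h ε h')

theorem measurable_partialTime {u : ℝ × ℝ → ℝ} (hu : Continuous u) :
    Measurable (partialTime u) := by
  have hc : Continuous (Function.uncurry fun s t : ℝ => u (t, s)) :=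
    hu.comp (continuous_snd.prodMk continuous_fst)
  exact (measurable_deriv_with_param hc).comp measurable_swap

theorem measurable_partialSpace {u : ℝ × ℝ → ℝ} (hu : Continuous u) :
    Measurable (partialSpace u) := by
  have hc : Continuous (Function.uncurry fun t s : ℝ => u (t, s)) := hu
  exact measurable_deriv_with_param hc

theorem locallyIntegrableOn_of_bounded {g : ℝ × ℝ → ℝ} (hg : Measurable g) {J I : Set ℝ}
    (hI : IsOpen I) (hJ : J ⊆ I) (hb : ∀ T ∈ I, ∃ C, ∀ z : ℝ × ℝ, z.1 < T → |g z| ≤ C) :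
    LocallyIntegrableOn g (J ×ˢ univ) := by
  intro z hz
  obtain ⟨T, hzT, hT⟩ : ∃ T, z.1 < T ∧ T ∈ I := by
    obtain ⟨ε, hε, hball⟩ := Metric.isOpen_iff.1 hI z.1 (hJ hz.1)
    refine ⟨z.1 + ε / 2, by linarith, hball ?_⟩
    rw [Metric.mem_ball, Real.dist_eq, add_sub_cancel_left, abs_of_pos (by linarith)]
    linarith
  obtain ⟨C, hC⟩ := hb T hT
  have hopen : IsOpen (Metric.ball z 1 ∩ {w : ℝ × ℝ | w.1 < T}) :=
    Metric.isOpen_ball.inter (isOpen_lt continuous_fst continuous_const)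
  refine ⟨Metric.ball z 1 ∩ {w : ℝ × ℝ | w.1 < T},
    mem_nhdsWithin_of_mem_nhds (hopen.mem_nhds ⟨Metric.mem_ball_self one_pos, hzT⟩), ?_⟩
  refine Measure.integrableOn_of_bounded (M := C) ?_ hg.aestronglyMeasurable ?_
  · exact ((measure_mono inter_subset_left).trans_lt
      (measure_ball_lt_top (μ := volume) (x := z) (r := 1))).ne
  · exact (ae_restrict_iff' hopen.measurableSet).2 (ae_of_all _ fun w hw => hC w hw.2)

namespace IsTestFunction

variable {J : Set ℝ} {φ : ℝ × ℝ → ℝ}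

theorem eq_zero (hφ : IsTestFunction J φ) {I : Set ℝ} (hJ : interior J ⊆ I) (z : ℝ × ℝ)
    (hz : z.1 ∉ I) : φ z = 0 :=
  image_eq_zero_of_notMem_tsupport fun h => hz (hJ (hφ.support_subset h).1)

theorem exists_time_bound (hφ : IsTestFunction J φ) {I : Set ℝ} (hJ : interior J ⊆ I)
    (h0 : 0 ∈ I) : ∃ T ∈ I, ∀ z ∈ tsupport φ, z.1 ≤ T := by
  rcases (tsupport φ).eq_empty_or_nonempty with he | hne
  · exact ⟨0, h0, by simp [he]⟩
  · obtain ⟨z, hz, hmax⟩ := hφ.compact_support.isCompact.exists_isMaxOn hne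
      continuous_fst.continuousOn
    exact ⟨z.1, hJ (hφ.support_subset hz).1, fun w hw => hmax hw⟩

end IsTestFunction

namespace IsWorldline

variable {I J : Set ℝ} {q v : ℝ → ℝ}

/-- The time derivative of a test function along the trajectory. -/
theorem hasDerivAt_comp_worldline (h : IsWorldline I q v) (hJ : interior J ⊆ I)
    {φ : ℝ × ℝ → ℝ} (hφ : IsTestFunction J φ) (t : ℝ) :
    HasDerivAt (fun t => φ (t, q t)) (((1 + v t) * charDeriv 1 φ (t, q t)
      + (1 - v t) * charDeriv (-1) φ (t, q t)) / 2) t := by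
  have h1 : ContDiff ℝ 1 φ := hφ.smooth.of_le (by simp)
  have hd : Differentiable ℝ φ := h1.differentiable (by simp)
  by_cases ht : t ∈ I
  · have hg : HasDerivAt (fun t => (t, q t)) ((1 : ℝ), v t) t :=
      (hasDerivAt_id t).prodMk (h.hasDerivAt t ht)
    refine (HasFDerivAt.comp_hasDerivAt (f := fun t : ℝ => (t, q t)) t
      (hd _).hasFDerivAt hg).congr_deriv ?_
    have e : ((1 : ℝ), v t) = ((1 + v t) / 2) • ((1 : ℝ), (1 : ℝ))
        + ((1 - v t) / 2) • ((1 : ℝ), (-1 : ℝ)) := by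
      ext
      · simp; ring
      · simp; ring
    rw [charDeriv_eq_fderiv hd, charDeriv_eq_fderiv hd, e, map_add, map_smul, map_smul]
    simp only [smul_eq_mul]
    ring
  -- Outside `I` nothing is known about the derivative of `q`, but the test function vanishes near
  -- that point of the trajectory.
  · have hn : (t, q t) ∉ tsupport φ := fun h' => ht (hJ (hφ.support_subset h').1)
    rw [charDeriv_eq_zero_of_notMem_tsupport h1 _ hn,
      charDeriv_eq_zero_of_notMem_tsupport h1 _ hn]
    simp only [mul_zero, add_zero, zero_div]
    refine (hasDerivAt_const t (0 : ℝ)).congr_of_eventuallyEq ?_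
    have hcont : Continuous fun t => (t, q t) := continuous_id.prodMk h.continuous
    filter_upwards [hcont.continuousAt.eventually
      ((isClosed_tsupport φ).isOpen_compl.mem_nhds hn)] with t' ht'
    exact image_eq_zero_of_notMem_tsupport ht'

theorem integrable_mul_comp_worldline (h : IsWorldline I q v) {φ : ℝ × ℝ → ℝ}
    (hφ : IsTestFunction J φ) {g : ℝ → ℝ} (hg : Continuous g) :
    Integrable fun t => g t * φ (t, q t) :=
  (hg.mul (hφ.smooth.continuous.comp
    (continuous_id.prodMk h.continuous))).integrable_of_hasCompactSupport
    (hasCompactSupport_comp_shear hφ.compact_support q).mul_left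

theorem isSourcedWave_jointField (h : IsWorldline I q v) (hJ : interior J ⊆ I) (a : ℝ)
    {x y : ℝ → ℝ} (hx : Continuous x) (hy : Continuous y) :
    IsSourcedWave a J (jointField a x y q) q where
  locally_integrable :=
    (h.continuous_jointField a hx hy).locallyIntegrable.locallyIntegrableOn _
  weak_equation φ hφ := by
    have hp := hφ.charDeriv 1
    have hm := hφ.charDeriv (-1)
    have hp1 : ContDiff ℝ 1 (charDeriv 1 φ) := hp.smooth.of_le (by simp)
    have hm1 : ContDiff ℝ 1 (charDeriv (-1) φ) := hm.smooth.of_le (by simp)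
    have hR := h.continuous_retardedTime
    have hL := h.neg.continuous_retardedTime
    -- The term `-(a / 2) * t` of the field is split as `-(a / 4) * (t - s) - (a / 4) * (t + s)` and
    -- absorbed into the two free waves.
    have hX : Continuous fun ξ => x ξ - a / 4 * ξ := by fun_prop
    have hY : Continuous fun η => y η - a / 4 * η := by fun_prop
    have hR2 : Continuous fun ξ => a / 2 * retardedTime q ξ := by fun_prop
    have hL2 : Continuous fun ξ => a / 2 * retardedTime (fun t => -q t) ξ := by fun_prop
    have i1 := integral_mul_charDeriv_eq_zero (ε := 1) (by norm_num) hm1 hm.compact_support hX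
    have i2 := integral_mul_charDeriv_eq_zero (ε := -1) (by norm_num) hp1 hp.compact_support hY
    have i3 := h.integral_right_charDeriv hm1 hm.compact_support (hm.eq_zero hJ) hR2
    have i4 := h.integral_left_charDeriv hp1 hp.compact_support (hp.eq_zero hJ) hL2
    simp only [one_mul, neg_one_mul, sub_neg_eq_add] at i1 i2
    have j1 := integrable_mul_charDeriv hm1 hm.compact_support 1
      (X := fun z => (x (z.1 - z.2) - a / 4 * (z.1 - z.2))) (by fun_prop)
    have j2 := integrable_mul_charDeriv hp1 hp.compact_support (-1)
      (X := fun z => (y (z.1 + z.2) - a / 4 * (z.1 + z.2))) (by fun_prop)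
    have j3 := integrable_indicator_mul_charDeriv hm1 hm.compact_support 1
      (X := fun z => a / 2 * retardedTime q (z.1 - z.2)) (by fun_prop) h.continuous
    have j4 := integrable_indicator_mul_charDeriv hp1 hp.compact_support (-1)
      (X := fun z => a / 2 * retardedTime (fun t => -q t) (z.1 + z.2)) (by fun_prop) h.continuous
    simp only [one_mul, neg_one_mul, neg_sub, sub_pos] at j3 j4
    have key : ∀ᵐ z : ℝ × ℝ, jointField a x y q z *
        (partialTime (partialTime φ) z - partialSpace (partialSpace φ) z)
        = ((x (z.1 - z.2) - a / 4 * (z.1 - z.2)) * charDeriv 1 (charDeriv (-1) φ) z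
          + (y (z.1 + z.2) - a / 4 * (z.1 + z.2)) * charDeriv (-1) (charDeriv 1 φ) z)
        + ({z : ℝ × ℝ | q z.1 < z.2}.indicator (fun z => a / 2 * retardedTime q (z.1 - z.2)
            * charDeriv 1 (charDeriv (-1) φ) z) z
          + {z : ℝ × ℝ | z.2 < q z.1}.indicator (fun z => a / 2 *
            retardedTime (fun t => -q t) (z.1 + z.2) * charDeriv (-1) (charDeriv 1 φ) z) z) := by
      filter_upwards [ae_snd_ne h.continuous] with z hz
      have e1 := charDeriv_charDeriv_neg hφ.smooth (ε := 1) (by norm_num) z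
      have e2 := charDeriv_charDeriv_neg hφ.smooth (ε := -1) (by norm_num) z
      rw [neg_neg] at e2
      rcases lt_or_gt_of_ne hz with hlt | hlt
      · rw [indicator_of_notMem (show z ∉ {z : ℝ × ℝ | q z.1 < z.2} from not_lt.2 hlt.le),
          indicator_of_mem (show z ∈ {z : ℝ × ℝ | z.2 < q z.1} from hlt), e1, e2, jointField,
          h.min_retardedTime_of_ge hlt.le]
        ring
      · rw [indicator_of_notMem (show z ∉ {z : ℝ × ℝ | z.2 < q z.1} from not_lt.2 hlt.le),
          indicator_of_mem (show z ∈ {z : ℝ × ℝ | q z.1 < z.2} from hlt), e1, e2, jointField,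
          h.min_retardedTime_of_le hlt.le]
        ring
    rw [integral_congr_ae key, integral_add_add_add j1 j2 j3 j4, i1, i2, i3, i4]
    simp only [h.retardedTime_sub]
    have hLt : ∀ t, retardedTime (fun t => -q t) (t + q t) = t := fun t => by
      simpa using h.neg.retardedTime_sub t
    simp only [hLt]
    have hv := h.continuous_velocity
    have k1 := h.integrable_mul_comp_worldline hm (g := fun t => (1 - v t) * (a / 2 * t))
      (by fun_prop)
    have k2 := h.integrable_mul_comp_worldline hp (g := fun t => (1 + v t) * (a / 2 * t))
      (by fun_prop)
    have k3 := h.integrable_mul_comp_worldline hφ (g := fun _ => a) continuous_const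
    have k4 := h.integrable_mul_comp_worldline hφ (g := fun t => a * t) (by fun_prop)
    -- On the trajectory both retarded times equal `t`, so the two line integrals, together with the
    -- integral of `a * φ`, form the integral of a total derivative, which vanishes.
    have hder : ∀ t, HasDerivAt (fun t => a * t * φ (t, q t)) (a * φ (t, q t)
        + ((1 - v t) * (a / 2 * t) * charDeriv (-1) φ (t, q t)
          + (1 + v t) * (a / 2 * t) * charDeriv 1 φ (t, q t))) t := fun t =>
      ((((hasDerivAt_id t).const_mul a).mul (h.hasDerivAt_comp_worldline hJ hφ t))).congr_deriv
        (by simp only [id]; ring)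
    have hz := integral_eq_zero_of_hasDerivAt_of_integrable hder (k3.add (k1.add k2)) k4
    have hs := (integral_add k3 (k1.add k2)).symm.trans hz
    have hs2 := integral_add k1 k2
    simp only [Pi.add_apply] at hs
    rw [hs2, integral_const_mul] at hs
    linarith

/-- A Lipschitz bound controls `deriv` everywhere, including on the trajectory, where the field has
a kink; there `deriv` takes the value `0` if the derivative does not exist. -/
theorem exists_bound_partial_jointField (h : IsWorldline I q v) (a : ℝ) {x y : ℝ → ℝ} {C : ℝ}
    (hx : ∀ ξ ξ', |x ξ - x ξ'| ≤ C * |ξ - ξ'|) (hy : ∀ ξ ξ', |y ξ - y ξ'| ≤ C * |ξ - ξ'|)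
    {T : ℝ} (hT : T ∈ I) : ∃ K, ∀ z : ℝ × ℝ, z.1 < T →
      |partialTime (jointField a x y q) z| ≤ K ∧ |partialSpace (jointField a x y q) z| ≤ K := by
  obtain ⟨κ, hκ1, hκ⟩ := h.exists_velocity_bound hT
  set K := 4 * C + |a| / 2 * (2 * (1 - κ)⁻¹ + 1)
  have hlip : ∀ z w : ℝ × ℝ, z.1 ≤ T → w.1 ≤ T →
      |jointField a x y q z - jointField a x y q w| ≤ K * dist z w := fun z w hz hw =>
    h.abs_jointField_sub_le a hx hy hT hκ1 hκ hz hw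
  have hC : 0 ≤ C := by
    have := (abs_nonneg _).trans (hx 1 0)
    simpa using this
  have hK : 0 ≤ K := by
    have : 0 ≤ (1 - κ)⁻¹ := inv_nonneg.2 (by linarith)
    positivity
  refine ⟨K, fun z hz => ⟨?_, ?_⟩⟩
  · have := norm_deriv_le_of_lipschitzOn (f := fun t => jointField a x y q (t, z.2))
      (C := K.toNNReal) (Iio_mem_nhds hz) (LipschitzOnWith.of_dist_le_mul fun t ht t' ht' => by
        rw [Real.coe_toNNReal K hK, Real.dist_eq]
        refine (hlip (t, z.2) (t', z.2) (le_of_lt ht) (le_of_lt ht')).trans_eq ?_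
        simp [Prod.dist_eq])
    rwa [Real.coe_toNNReal K hK] at this
  · have := norm_deriv_le_of_lipschitz (f := fun s => jointField a x y q (z.1, s))
      (C := K.toNNReal) (x₀ := z.2) (LipschitzWith.of_dist_le_mul fun s s' => by
        rw [Real.coe_toNNReal K hK, Real.dist_eq]
        refine (hlip (z.1, s) (z.1, s') hz.le hz.le).trans_eq ?_
        simp [Prod.dist_eq])
    rwa [Real.coe_toNNReal K hK] at this

/-- With `D₊`, `D₋` the characteristic derivatives, the integrand is `((u_t - u_s) / 2) ^ 2 * D₊ φ -
((u_t + u_s) / 2) ^ 2 * D₋ φ`. Each square is a function of a single null coordinate on either side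
of the trajectory, so only its jump across the trajectory contributes to the force. -/
theorem momentum_balance_jointField (h : IsWorldline I q v) (hJ : interior J ⊆ I) (a : ℝ)
    {x y x' y' : ℝ → ℝ} (hx : ∀ ξ, HasDerivAt x (x' ξ) ξ) (hy : ∀ ξ, HasDerivAt y (y' ξ) ξ)
    (hx' : Continuous x') (hy' : Continuous y') {f : ℝ → ℝ}
    (hf : ∀ t ∈ I, f t = a * (y' (t + q t) - x' (t - q t)) - a ^ 2 / 2 * (v t / (1 - v t ^ 2)))
    {φ : ℝ × ℝ → ℝ} (hφ : IsTestFunction J φ) :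
    ∫ z, (fieldStress (jointField a x y q) z * partialSpace φ z
      - momentumDensity (jointField a x y q) z * partialTime φ z) = ∫ t, f t * φ (t, q t) := by
  obtain ⟨T, hT, hTφ⟩ := hφ.exists_time_bound hJ h.zero_mem
  have h1 : ContDiff ℝ 1 φ := hφ.smooth.of_le (by simp)
  have hv := h.continuous_velocity
  -- The test function lives before `T`. Evaluating the velocity at `min t T` keeps the denominators
  -- nonzero, hence `r` and `l` continuous on the whole line.
  have hminI : ∀ t, min t T ∈ I := fun t => h.mem_of_le T hT _ (min_le_right _ _)
  have hvp : ∀ t, t ∈ I → 1 - v t ≠ 0 := fun t ht => by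
    linarith [(abs_lt.1 (h.subluminal t ht)).2]
  have hvm : ∀ t, t ∈ I → 1 + v t ≠ 0 := fun t ht => by
    linarith [(abs_lt.1 (h.subluminal t ht)).1]
  have hr : Continuous fun ξ => 1 / (1 - v (min (retardedTime q ξ) T)) := by
    have := h.continuous_retardedTime
    exact continuous_const.div (by fun_prop) fun ξ => hvp _ (hminI _)
  have hl : Continuous fun η => 1 / (1 + v (min (retardedTime (fun t => -q t) η) T)) := by
    have := h.neg.continuous_retardedTime
    exact continuous_const.div (by fun_prop) fun ξ => hvm _ (hminI _)
  set r := fun ξ => 1 / (1 - v (min (retardedTime q ξ) T)) with hrdef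
  set l := fun η => 1 / (1 + v (min (retardedTime (fun t => -q t) η) T)) with hldef
  set A := fun ξ => x' ξ - a / 4 with hA
  set B := fun η => y' η - a / 4 with hB
  have hAc : Continuous A := by fun_prop
  have hBc : Continuous B := by fun_prop
  have hX0 : Continuous fun ξ => A ξ ^ 2 := by fun_prop
  have hY0 : Continuous fun η => B η ^ 2 := by fun_prop
  have hX : Continuous fun ξ => (A ξ + a / 2 * r ξ) ^ 2 - A ξ ^ 2 := by fun_prop
  have hY : Continuous fun η => (B η + a / 2 * l η) ^ 2 - B η ^ 2 := by fun_prop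
  have i1 := integral_mul_charDeriv_eq_zero (ε := 1) (by norm_num) h1 hφ.compact_support hX0
  have i2 := integral_mul_charDeriv_eq_zero (ε := -1) (by norm_num) h1 hφ.compact_support hY0
  have i3 := h.integral_right_charDeriv h1 hφ.compact_support (hφ.eq_zero hJ) hX
  have i4 := h.integral_left_charDeriv h1 hφ.compact_support (hφ.eq_zero hJ) hY
  simp only [one_mul, neg_one_mul, sub_neg_eq_add] at i1 i2
  have j1 := integrable_mul_charDeriv h1 hφ.compact_support 1
    (X := fun z => A (z.1 - z.2) ^ 2) (by fun_prop)
  have j2 := integrable_mul_charDeriv h1 hφ.compact_support (-1)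
    (X := fun z => B (z.1 + z.2) ^ 2) (by fun_prop)
  have j3 := integrable_indicator_mul_charDeriv h1 hφ.compact_support 1
    (X := fun z => (A (z.1 - z.2) + a / 2 * r (z.1 - z.2)) ^ 2 - A (z.1 - z.2) ^ 2)
    (by fun_prop) h.continuous
  have j4 := integrable_indicator_mul_charDeriv h1 hφ.compact_support (-1)
    (X := fun z => (B (z.1 + z.2) + a / 2 * l (z.1 + z.2)) ^ 2 - B (z.1 + z.2) ^ 2)
    (by fun_prop) h.continuous
  simp only [one_mul, neg_one_mul, neg_sub, sub_pos] at j3 j4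
  have key : ∀ᵐ z : ℝ × ℝ, fieldStress (jointField a x y q) z * partialSpace φ z
      - momentumDensity (jointField a x y q) z * partialTime φ z
      = (A (z.1 - z.2) ^ 2 * charDeriv 1 φ z - B (z.1 + z.2) ^ 2 * charDeriv (-1) φ z)
      + ({z : ℝ × ℝ | q z.1 < z.2}.indicator (fun z => ((A (z.1 - z.2) + a / 2 * r (z.1 - z.2)) ^ 2
          - A (z.1 - z.2) ^ 2) * charDeriv 1 φ z) z
        - {z : ℝ × ℝ | z.2 < q z.1}.indicator (fun z => ((B (z.1 + z.2) + a / 2 * l (z.1 + z.2)) ^ 2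
          - B (z.1 + z.2) ^ 2) * charDeriv (-1) φ z) z) := by
    filter_upwards [ae_snd_ne h.continuous] with z hz
    have et : partialTime φ z = (charDeriv 1 φ z + charDeriv (-1) φ z) / 2 := by
      simp only [charDeriv]; ring
    have es : partialSpace φ z = (charDeriv 1 φ z - charDeriv (-1) φ z) / 2 := by
      simp only [charDeriv]; ring
    rw [et, es]
    by_cases hzs : z ∈ tsupport φ
    · have hzT := hTφ z hzs
      have hI : ∀ t < z.1, t ∈ I := fun t ht => h.mem_of_le T hT t (ht.le.trans hzT)
      rcases lt_or_gt_of_ne hz with hlt | hlt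
      · obtain ⟨p1, p2⟩ := h.partial_jointField_left a hx hy hlt hI
        have hmin : min (retardedTime (fun t => -q t) (z.1 + z.2)) T
            = retardedTime (fun t => -q t) (z.1 + z.2) := by
          refine min_eq_left (le_trans (le_of_lt ?_) hzT)
          rw [h.neg.retardedTime_lt_iff]
          linarith
        rw [indicator_of_notMem (show z ∉ {z : ℝ × ℝ | q z.1 < z.2} from not_lt.2 hlt.le),
          indicator_of_mem (show z ∈ {z : ℝ × ℝ | z.2 < q z.1} from hlt)]
        simp only [fieldStress, momentumDensity, p1, p2, hldef, hmin, hA, hB]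
        ring
      · obtain ⟨p1, p2⟩ := h.partial_jointField_right a hx hy hlt hI
        have hmin : min (retardedTime q (z.1 - z.2)) T = retardedTime q (z.1 - z.2) := by
          refine min_eq_left (le_trans (le_of_lt ?_) hzT)
          rw [h.retardedTime_lt_iff]
          linarith
        rw [indicator_of_notMem (show z ∉ {z : ℝ × ℝ | z.2 < q z.1} from not_lt.2 hlt.le),
          indicator_of_mem (show z ∈ {z : ℝ × ℝ | q z.1 < z.2} from hlt)]
        simp only [fieldStress, momentumDensity, p1, p2, hrdef, hmin, hA, hB]
        ring
    · have c1 := charDeriv_eq_zero_of_notMem_tsupport h1 1 hzs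
      have c2 := charDeriv_eq_zero_of_notMem_tsupport h1 (-1) hzs
      simp only [indicator, c1, c2]
      simp
  rw [integral_congr_ae key, integral_sub_add_sub j1 j2 j3 j4, i1, i2, i3, i4]
  have hq := h.continuous
  have k1 := h.integrable_mul_comp_worldline hφ
    (g := fun t => (1 - v t) * ((A (t - q t) + a / 2 * r (t - q t)) ^ 2 - A (t - q t) ^ 2))
    (by fun_prop)
  have k2 := h.integrable_mul_comp_worldline hφ
    (g := fun t => (1 + v t) * ((B (t + q t) + a / 2 * l (t + q t)) ^ 2 - B (t + q t) ^ 2))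
    (by fun_prop)
  rw [sub_zero, zero_add, sub_neg_eq_add, add_comm, ← sub_eq_add_neg, ← integral_sub k2 k1]
  refine integral_congr_ae (ae_of_all _ fun t => ?_)
  by_cases hts : (t, q t) ∈ tsupport φ
  · have htI : t ∈ I := hJ (hφ.support_subset hts).1
    have htT : min t T = t := min_eq_left (hTφ _ hts)
    have hLt : retardedTime (fun t => -q t) (t + q t) = t := by
      simpa using h.neg.retardedTime_sub t
    have n1 := hvp t htI
    have n2 := hvm t htI
    have n3 : 1 - v t ^ 2 ≠ 0 := by
      rw [show 1 - v t ^ 2 = (1 - v t) * (1 + v t) by ring]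
      exact mul_ne_zero n1 n2
    -- The Jacobian factor cancels one pole: the right side gives `a * A + (a ^ 2 / 4) / (1 - v)`,
    -- the left side `a * B + (a ^ 2 / 4) / (1 + v)`, and their difference is the force.
    simp only [hf t htI, hrdef, hldef, h.retardedTime_sub, hLt, htT, hA, hB]
    rw [← sub_mul]
    congr 1
    field_simp
    ring
  · simp [image_eq_zero_of_notMem_tsupport hts]

theorem isKiesslingForce_jointField (h : IsWorldline I q v) (hJ : interior J ⊆ I) (a : ℝ)
    {x y x' y' : ℝ → ℝ} (hx : ∀ ξ, HasDerivAt x (x' ξ) ξ) (hy : ∀ ξ, HasDerivAt y (y' ξ) ξ)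
    (hx' : Continuous x') (hy' : Continuous y') {C : ℝ}
    (hxC : ∀ ξ ξ', |x ξ - x ξ'| ≤ C * |ξ - ξ'|) (hyC : ∀ ξ ξ', |y ξ - y ξ'| ≤ C * |ξ - ξ'|)
    {f : ℝ → ℝ} (hfc : ContinuousOn f J)
    (hf : ∀ t ∈ I, f t = a * (y' (t + q t) - x' (t - q t)) - a ^ 2 / 2 * (v t / (1 - v t ^ 2))) :
    IsKiesslingForce J (jointField a x y q) q f where
  continuous_force := hfc
  momentum_balance φ hφ := h.momentum_balance_jointField hJ a hx hy hx' hy' hf hφ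
  momentum_integrable := by
    have hu : Continuous (jointField a x y q) := h.continuous_jointField a
      (continuous_iff_continuousAt.2 fun ξ => (hx ξ).continuousAt)
      (continuous_iff_continuousAt.2 fun ξ => (hy ξ).continuousAt)
    refine locallyIntegrableOn_of_bounded
      ((measurable_partialSpace hu).mul (measurable_partialTime hu)) h.isOpen hJ fun T hT => ?_
    obtain ⟨K, hK⟩ := h.exists_bound_partial_jointField a hxC hyC hT
    refine ⟨K * K, fun z hz => ?_⟩
    obtain ⟨b1, b2⟩ := hK z hz
    rw [Pi.mul_apply, abs_mul]
    exact mul_le_mul b2 b1 (abs_nonneg _) ((abs_nonneg _).trans b1)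
  stress_integrable := by
    have hu : Continuous (jointField a x y q) := h.continuous_jointField a
      (continuous_iff_continuousAt.2 fun ξ => (hx ξ).continuousAt)
      (continuous_iff_continuousAt.2 fun ξ => (hy ξ).continuousAt)
    refine locallyIntegrableOn_of_bounded
      ((((measurable_partialSpace hu).pow_const 2).add
        ((measurable_partialTime hu).pow_const 2)).div_const 2) h.isOpen hJ fun T hT => ?_
    obtain ⟨K, hK⟩ := h.exists_bound_partial_jointField a hxC hyC hT
    refine ⟨K ^ 2, fun z hz => ?_⟩
    obtain ⟨b1, b2⟩ := hK z hz
    have c1 := sq_le_sq' (abs_le.1 b1).1 (abs_le.1 b1).2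
    have c2 := sq_le_sq' (abs_le.1 b2).1 (abs_le.1 b2).2
    simp only [Pi.add_apply]
    rw [abs_of_nonneg (by positivity)]
    linarith

end IsWorldline

/-! ### The equation of motion for the angle. -/

/-- Global solvability of ordinary differential equations with a bounded, globally Lipschitz
right-hand side. -/
theorem exists_global_solution {E : Type*} [NormedAddCommGroup E] [NormedSpace ℝ E]
    [CompleteSpace E] {f : ℝ → E → E} {K L : NNReal} (hlip : ∀ t, LipschitzWith K (f t))
    (hcont : ∀ x, Continuous fun t => f t x) (hbd : ∀ t x, ‖f t x‖ ≤ L) (x₀ : E) :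
    ∃ γ : ℝ → E, γ 0 = x₀ ∧ ∀ t, HasDerivAt γ (f t (γ t)) t := by
  have hloc : ∀ n : ℕ, ∃ γ : ℝ → E, γ 0 = x₀ ∧
      ∀ t ∈ Ioo (-((n : ℝ) + 1)) (n + 1), HasDerivAt γ (f t (γ t)) t := by
    intro n
    have hn : (0 : ℝ) < n + 1 := by positivity
    -- The radius `L * (n + 1)` is the farthest a solution of speed at most `L` can travel, so no
    -- smallness of time is needed.
    have hpl : IsPicardLindelof f (tmin := -((n : ℝ) + 1)) (tmax := n + 1)
        ⟨0, by constructor <;> linarith⟩ x₀ (L * (n + 1)) 0 L K :=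
      { lipschitzOnWith := fun t _ => (hlip t).lipschitzOnWith
        continuousOn := fun x _ => (hcont x).continuousOn
        norm_le := fun t _ x _ => hbd t x
        mul_max_le := by simp }
    obtain ⟨γ, h0, hγ⟩ := hpl.exists_eq_forall_mem_Icc_hasDerivWithinAt₀
    exact ⟨γ, h0, fun t ht => (hγ t (Ioo_subset_Icc_self ht)).hasDerivAt (Icc_mem_nhds ht.1 ht.2)⟩
  choose γ h0 hγ using hloc
  have hle : ∀ n m : ℕ, n ≤ m → EqOn (γ n) (γ m) (Ioo (-((n : ℝ) + 1)) (n + 1)) := by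
    intro n m hnm
    have hn : (0 : ℝ) < n + 1 := by positivity
    have hnm' : (n : ℝ) ≤ m := Nat.cast_le.2 hnm
    exact ODE_solution_unique_of_mem_Ioo (v := f) (s := fun _ => univ) (K := K) (t₀ := 0)
      (fun t _ => (hlip t).lipschitzOnWith) ⟨by linarith, hn⟩
      (fun t ht => ⟨hγ n t ht, mem_univ _⟩)
      (fun t ht => ⟨hγ m t ⟨by linarith [ht.1], by linarith [ht.2]⟩, mem_univ _⟩)
      ((h0 n).trans (h0 m).symm)
  have hagree : ∀ (n m : ℕ) (t : ℝ), |t| < n + 1 → |t| < m + 1 → γ n t = γ m t := by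
    intro n m t hn hm
    rcases le_total n m with h | h
    · exact hle n m h (abs_lt.1 hn)
    · exact (hle m n h (abs_lt.1 hm)).symm
  have hceil : ∀ t : ℝ, |t| < (⌈|t|⌉₊ : ℝ) + 1 := fun t => by linarith [Nat.le_ceil |t|]
  refine ⟨fun t => γ ⌈|t|⌉₊ t, h0 _, fun t => ?_⟩
  refine (hγ _ t (abs_lt.1 (hceil t))).congr_of_eventuallyEq ?_
  filter_upwards [(continuous_abs.isOpen_preimage _ isOpen_Iio).mem_nhds
    (show t ∈ abs ⁻¹' Iio ((⌈|t|⌉₊ : ℝ) + 1) from hceil t)] with t' ht'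
  exact hagree _ _ t' (hceil t') ht'

/-- Driven particle motion in terms of the angle `θ` with velocity `sin θ`, started from rest. -/
structure IsDrivenMotion (c k : ℝ) (F : ℝ → ℝ → ℝ) (θ q : ℝ → ℝ) : Prop where
  angle : ∀ t, HasDerivAt θ (c * F t (q t) * Real.cos (θ t) ^ 2 - k * Real.sin (θ t)) t
  position : ∀ t, HasDerivAt q (Real.sin (θ t)) t
  angle_zero : ∀ t ≤ 0, θ t = 0
  position_zero : ∀ t ≤ 0, q t = 0

/-- In the angle variable only `sin`, `cos` and the bounded Lipschitz drive occur, so the system is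
bounded and globally Lipschitz in `(θ, q)`. -/
theorem exists_isDrivenMotion (c k : ℝ) {F : ℝ → ℝ → ℝ} {K M : ℝ} (hK : 0 ≤ K)
    (hFK : ∀ t q q', |F t q - F t q'| ≤ K * |q - q'|) (hFM : ∀ t q, |F t q| ≤ M)
    (hFc : ∀ q, Continuous fun t => F t q) (hF0 : ∀ t ≤ 0, F t 0 = 0) :
    ∃ θ q, IsDrivenMotion c k F θ q := by
  have hM : 0 ≤ M := (abs_nonneg _).trans (hFM 0 0)
  set f : ℝ → ℝ × ℝ → ℝ × ℝ := fun t x =>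
    (c * F t x.2 * Real.cos x.1 ^ 2 - k * Real.sin x.1, Real.sin x.1) with hf
  have hsin : ∀ x y : ℝ, |Real.sin x - Real.sin y| ≤ |x - y| := fun x y => by
    simpa [Real.dist_eq] using Real.lipschitzWith_sin.dist_le_mul x y
  have hcos : ∀ x y : ℝ, |Real.cos x - Real.cos y| ≤ |x - y| := fun x y => by
    simpa [Real.dist_eq] using Real.lipschitzWith_cos.dist_le_mul x y
  set K₁ : ℝ := |c| * (K + 2 * M) + |k| + 1 with hK₁
  have hK₁0 : 0 ≤ K₁ := by positivity
  set L₁ : ℝ := |c| * M + |k| + 1 with hL₁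
  have hL₁0 : 0 ≤ L₁ := by positivity
  have hlip : ∀ t, LipschitzWith K₁.toNNReal (f t) := by
    intro t
    refine LipschitzWith.of_dist_le_mul fun x y => ?_
    rw [Real.coe_toNNReal _ hK₁0]
    have h1 : |x.1 - y.1| ≤ dist x y := le_max_left _ _
    have h2 : |x.2 - y.2| ≤ dist x y := le_max_right _ _
    have hd : 0 ≤ dist x y := dist_nonneg
    refine max_le ?_ ?_
    · have e : (f t x).1 - (f t y).1 = c * ((F t x.2 - F t y.2) * Real.cos x.1 ^ 2
          + F t y.2 * ((Real.cos x.1 - Real.cos y.1) * (Real.cos x.1 + Real.cos y.1)))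
          - k * (Real.sin x.1 - Real.sin y.1) := by
        simp only [hf]; ring
      rw [Real.dist_eq, e]
      have c1 : |Real.cos x.1 ^ 2| ≤ 1 := by
        rw [abs_of_nonneg (sq_nonneg _)]
        exact Real.cos_sq_le_one _
      have c2 : |Real.cos x.1 + Real.cos y.1| ≤ 2 := (abs_add_le _ _).trans
        (by linarith [Real.abs_cos_le_one x.1, Real.abs_cos_le_one y.1])
      have b1 : |F t x.2 - F t y.2| ≤ K * dist x y :=
        (hFK t _ _).trans (mul_le_mul_of_nonneg_left h2 hK)
      have b2 : |Real.cos x.1 - Real.cos y.1| ≤ dist x y := (hcos _ _).trans h1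
      have b3 : |Real.sin x.1 - Real.sin y.1| ≤ dist x y := (hsin _ _).trans h1
      calc _ ≤ |c * ((F t x.2 - F t y.2) * Real.cos x.1 ^ 2
          + F t y.2 * ((Real.cos x.1 - Real.cos y.1) * (Real.cos x.1 + Real.cos y.1)))|
          + |k * (Real.sin x.1 - Real.sin y.1)| := abs_sub _ _
        _ ≤ |c| * (|F t x.2 - F t y.2| * |Real.cos x.1 ^ 2|
          + |F t y.2| * (|Real.cos x.1 - Real.cos y.1| * |Real.cos x.1 + Real.cos y.1|))
          + |k| * |Real.sin x.1 - Real.sin y.1| := by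
            rw [abs_mul, abs_mul]
            gcongr
            refine (abs_add_le _ _).trans_eq ?_
            rw [abs_mul, abs_mul, abs_mul]
        _ ≤ |c| * (K * dist x y * 1 + M * (dist x y * 2)) + |k| * dist x y := by
            gcongr
            exact hFM _ _
        _ ≤ K₁ * dist x y := by
            rw [hK₁]
            nlinarith
    · rw [Real.dist_eq]
      refine ((hsin x.1 y.1).trans h1).trans ?_
      have : 1 ≤ K₁ := by
        have : 0 ≤ |c| * (K + 2 * M) + |k| := by positivity
        linarith
      nlinarith
  have hbd : ∀ t x, ‖f t x‖ ≤ L₁.toNNReal := by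
    intro t x
    rw [Real.coe_toNNReal _ hL₁0]
    refine max_le ?_ ?_
    · rw [Real.norm_eq_abs]
      calc _ ≤ |c * F t x.2 * Real.cos x.1 ^ 2| + |k * Real.sin x.1| := abs_sub _ _
        _ = |c| * |F t x.2| * (Real.cos x.1 ^ 2) + |k| * |Real.sin x.1| := by
            rw [abs_mul, abs_mul, abs_mul, abs_of_nonneg (sq_nonneg (Real.cos x.1))]
        _ ≤ |c| * M * 1 + |k| * 1 := by
            gcongr
            exacts [hFM _ _, Real.cos_sq_le_one _, Real.abs_sin_le_one _]
        _ ≤ L₁ := by linarith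
    · refine (Real.abs_sin_le_one x.1).trans ?_
      have : 0 ≤ |c| * M + |k| := by positivity
      linarith
  have hcont : ∀ x, Continuous fun t => f t x := by
    intro x
    have := hFc x.2
    simp only [hf]
    fun_prop
  obtain ⟨γ, hγ0, hγ⟩ := exists_global_solution hlip hcont hbd 0
  have hzero : ∀ t ≤ 0, γ t = 0 := by
    intro t ht
    have hγc : Continuous γ := continuous_iff_continuousAt.2 fun s => (hγ s).continuousAt
    -- The drive vanishes at the origin for negative times, so rest is a solution there, and
    -- backward uniqueness identifies it with `γ`.
    refine ODE_solution_unique_of_mem_Icc_left (v := f) (s := fun _ => univ) (K := K₁.toNNReal)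
      (a := t) (b := 0) (g := fun _ => 0)
      (fun s _ => (hlip s).lipschitzOnWith) hγc.continuousOn
      (fun s _ => (hγ s).hasDerivWithinAt) (fun _ _ => mem_univ _)
      continuousOn_const (fun s hs => ?_) (fun _ _ => mem_univ _) hγ0 ⟨le_rfl, ht⟩
    have : f s 0 = 0 := by
      simp [hf, hF0 s hs.2]
    rw [this]
    exact hasDerivWithinAt_const _ _ _
  refine ⟨fun t => (γ t).1, fun t => (γ t).2, ?_, ?_, ?_, ?_⟩
  · exact fun t => (hγ t).fst
  · exact fun t => (hγ t).snd
  · exact fun t ht => by simp [hzero t ht]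
  · exact fun t ht => by simp [hzero t ht]

namespace IsDrivenMotion

variable {c k : ℝ} {F : ℝ → ℝ → ℝ} {θ q : ℝ → ℝ}

theorem continuous_angle (h : IsDrivenMotion c k F θ q) : Continuous θ :=
  continuous_iff_continuousAt.2 fun t => (h.angle t).continuousAt

theorem continuous_position (h : IsDrivenMotion c k F θ q) : Continuous q :=
  continuous_iff_continuousAt.2 fun t => (h.position t).continuousAt

theorem contDiff_position (h : IsDrivenMotion c k F θ q) : ContDiff ℝ 1 q := by
  rw [contDiff_one_iff_deriv]
  refine ⟨fun t => (h.position t).differentiableAt, ?_⟩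
  have : deriv q = fun t => Real.sin (θ t) := funext fun t => (h.position t).deriv
  rw [this]
  exact Real.continuous_sin.comp h.continuous_angle

theorem neg (h : IsDrivenMotion c k F θ q) :
    IsDrivenMotion c k (fun t s => -F t (-s)) (fun t => -θ t) (fun t => -q t) where
  angle t := (h.angle t).neg.congr_deriv (by simp only [neg_neg, Real.cos_neg, Real.sin_neg]; ring)
  position t := (h.position t).neg.congr_deriv (by rw [Real.sin_neg])
  angle_zero t ht := by rw [h.angle_zero t ht, neg_zero]
  position_zero t ht := by rw [h.position_zero t ht, neg_zero]

/-- The constant `b` is a barrier: whenever `θ = b`, damping beats the strongest possible drive and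
`θ` is decreasing. -/
theorem angle_le (h : IsDrivenMotion c k F θ q) {M b : ℝ} (hM : ∀ t s, |F t s| ≤ M) (hb : 0 ≤ b)
    (hlt : |c| * M * Real.cos b ^ 2 < k * Real.sin b) (t : ℝ) : θ t ≤ b := by
  rcases le_total t 0 with ht | ht
  · rw [h.angle_zero t ht]
    exact hb
  · refine image_le_of_deriv_right_lt_deriv_boundary (a := 0) (b := t) (B := fun _ => b)
      (B' := fun _ => 0) h.continuous_angle.continuousOn
      (fun x _ => (h.angle x).hasDerivWithinAt) (by rw [h.angle_zero 0 le_rfl]; exact hb)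
      (fun x => hasDerivAt_const x b) (fun x _ hx => ?_) ⟨ht, le_rfl⟩
    rw [hx]
    have h1 : c * F x (q x) ≤ |c| * M := (le_abs_self _).trans (by
      rw [abs_mul]
      exact mul_le_mul_of_nonneg_left (hM _ _) (abs_nonneg c))
    have h2 := mul_le_mul_of_nonneg_right h1 (sq_nonneg (Real.cos b))
    linarith

/-- Damping confines the angle to a compact part of `(-π/2, π/2)`. -/
theorem exists_abs_angle_le (h : IsDrivenMotion c k F θ q) {M : ℝ} (hM : ∀ t s, |F t s| ≤ M)
    (hk : 0 < k) : ∃ b, 0 ≤ b ∧ b < Real.pi / 2 ∧ ∀ t, |θ t| ≤ b := by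
  have hpi := Real.pi_pos
  -- At `b = π / 2` the drive term vanishes and the barrier condition reads `0 < k`; it persists for
  -- `b` slightly smaller.
  have hopen : IsOpen {b : ℝ | |c| * M * Real.cos b ^ 2 < k * Real.sin b} :=
    isOpen_lt (by fun_prop) (by fun_prop)
  have hmem : Real.pi / 2 ∈ {b : ℝ | |c| * M * Real.cos b ^ 2 < k * Real.sin b} := by
    simpa using hk
  have hev : ∀ᶠ b in nhdsWithin (Real.pi / 2) (Iio (Real.pi / 2)),
      |c| * M * Real.cos b ^ 2 < k * Real.sin b :=
    nhdsWithin_le_nhds (hopen.mem_nhds hmem)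
  obtain ⟨b, hb, hb0, hb1⟩ := (hev.and
    (Ioo_mem_nhdsLT (show (0 : ℝ) < Real.pi / 2 by linarith))).exists
  refine ⟨b, hb0.le, hb1, fun t => abs_le.2 ⟨?_, h.angle_le hM hb0.le hb t⟩⟩
  have := h.neg.angle_le (M := M) (fun t s => by rw [abs_neg]; exact hM _ _) hb0.le hb t
  linarith

/-- Once the driving force has ceased, damping brings the angle to `0`. -/
theorem tendsto_angle (h : IsDrivenMotion c k F θ q) (hk : 0 < k) {T : ℝ}
    (hF : ∀ t ≥ T, F t (q t) = 0) (hθ : ∀ t, |θ t| ≤ Real.pi / 2) :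
    Filter.Tendsto θ Filter.atTop (nhds 0) := by
  have hpi := Real.pi_pos
  -- Jordan's inequality `sin θ ≥ (2 / π) * θ` on `[0, π / 2]` bounds the damping below by a linear
  -- one, so `θ ^ 2` decays at rate `r`.
  set r : ℝ := 2 * (k * (2 / Real.pi)) with hr
  have hr0 : 0 < r := by positivity
  have hder : ∀ t, HasDerivAt (fun t => θ t ^ 2 * Real.exp (r * t))
      (2 * θ t * (c * F t (q t) * Real.cos (θ t) ^ 2 - k * Real.sin (θ t)) * Real.exp (r * t)
        + θ t ^ 2 * (Real.exp (r * t) * r)) t := by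
    intro t
    have h1 := (h.angle t).pow 2
    have h2 : HasDerivAt (fun t => Real.exp (r * t)) (Real.exp (r * t) * r) t := by
      simpa using ((hasDerivAt_id t).const_mul r).exp
    exact (h1.mul h2).congr_deriv (by simp)
  have hanti : AntitoneOn (fun t => θ t ^ 2 * Real.exp (r * t)) (Ici T) := by
    refine antitoneOn_of_hasDerivWithinAt_nonpos (convex_Ici T)
      (fun t _ => (hder t).continuousAt.continuousWithinAt)
      (fun t _ => (hder t).hasDerivWithinAt) (fun t ht => ?_)
    rw [hF t (mem_Ici.1 (interior_subset ht))]
    have hs : 2 / Real.pi * θ t ^ 2 ≤ θ t * Real.sin (θ t) := by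
      rcases le_total 0 (θ t) with h0 | h0
      · have := Real.mul_le_sin h0 ((le_abs_self _).trans (hθ t))
        nlinarith
      · have := Real.mul_le_sin (neg_nonneg.2 h0) ((neg_le_abs _).trans (hθ t))
        rw [Real.sin_neg] at this
        nlinarith
    have he := Real.exp_pos (r * t)
    have : 2 * θ t * (c * 0 * Real.cos (θ t) ^ 2 - k * Real.sin (θ t)) * Real.exp (r * t)
        + θ t ^ 2 * (Real.exp (r * t) * r)
        = -(2 * k * (θ t * Real.sin (θ t) - 2 / Real.pi * θ t ^ 2)) * Real.exp (r * t) := by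
      rw [hr]; ring
    rw [this]
    have hnn : 0 ≤ 2 * k * (θ t * Real.sin (θ t) - 2 / Real.pi * θ t ^ 2) :=
      mul_nonneg (by linarith) (by linarith)
    exact mul_nonpos_of_nonpos_of_nonneg (by linarith) he.le
  have hsq : Filter.Tendsto (fun t => θ t ^ 2) Filter.atTop (nhds 0) := by
    set C := θ T ^ 2 * Real.exp (r * T)
    have hexp : Filter.Tendsto (fun t => C * Real.exp (-(r * t))) Filter.atTop (nhds 0) := by
      have := (Real.tendsto_exp_neg_atTop_nhds_zero.comp
        (Filter.tendsto_id.const_mul_atTop hr0)).const_mul C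
      simpa using this
    refine squeeze_zero' (Filter.Eventually.of_forall fun t => sq_nonneg _) ?_ hexp
    filter_upwards [Filter.eventually_ge_atTop T] with t ht
    have := hanti (mem_Ici.2 le_rfl) (mem_Ici.2 ht) ht
    rw [Real.exp_neg, ← div_eq_mul_inv, le_div_iff₀ (Real.exp_pos _)]
    exact this
  have habs : Filter.Tendsto (fun t => |θ t|) Filter.atTop (nhds 0) := by
    have := hsq.sqrt
    simpa [Real.sqrt_sq_eq_abs] using this
  exact (tendsto_zero_iff_abs_tendsto_zero θ).2 habs

/-- Without damping, a nonnegative nontrivial drive makes the angle reach `π / 2`. -/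
theorem exists_angle_eq_pi_div_two (h : IsDrivenMotion c k F θ q) (hk : k < 0)
    (hF : ∀ t ≥ 0, 0 ≤ c * F t (q t)) (hne : ∃ t > 0, θ t ≠ 0) :
    ∃ T > 0, θ T = Real.pi / 2 ∧ ∀ t < T, 0 ≤ θ t ∧ θ t < Real.pi / 2 := by
  have hpi := Real.pi_pos
  have hc := h.continuous_angle
  -- Since `sin θ = θ * sinc θ`, the self-force term is linear in `θ` with a continuous coefficient,
  -- and `exp (-C)` is its integrating factor. A nonnegative drive makes `θ * exp (-C)`
  -- nondecreasing, so `θ` is nonnegative and stays positive once it is.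
  set C : ℝ → ℝ := fun t => ∫ τ in (0 : ℝ)..t, -k * Real.sinc (θ τ) with hC
  have hCc : Continuous fun τ => -k * Real.sinc (θ τ) :=
    continuous_const.mul (Real.continuous_sinc.comp hc)
  have hCd : ∀ t, HasDerivAt C (-k * Real.sinc (θ t)) t := fun t =>
    hCc.integral_hasStrictDerivAt 0 t |>.hasDerivAt
  have hsinc : ∀ x, x * Real.sinc x = Real.sin x := by
    intro x
    by_cases hx : x = 0
    · simp [hx]
    · rw [Real.sinc_of_ne_zero hx]
      field_simp
  have hyd : ∀ t, HasDerivAt (fun t => θ t * Real.exp (-C t))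
      (c * F t (q t) * Real.cos (θ t) ^ 2 * Real.exp (-C t)) t := fun t =>
    ((h.angle t).mul (hCd t).neg.exp).congr_deriv (by
      linear_combination (k * Real.exp (-C t)) * hsinc (θ t))
  have hymono : MonotoneOn (fun t => θ t * Real.exp (-C t)) (Ici 0) :=
    monotoneOn_of_hasDerivWithinAt_nonneg (convex_Ici 0)
      (fun t _ => (hyd t).continuousAt.continuousWithinAt)
      (fun t _ => (hyd t).hasDerivWithinAt) (fun t ht =>
        mul_nonneg (mul_nonneg (hF t (mem_Ici.1 (interior_subset ht))) (sq_nonneg _))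
          (Real.exp_pos _).le)
  have hnonneg : ∀ t, 0 ≤ θ t := by
    intro t
    rcases le_total t 0 with ht | ht
    · rw [h.angle_zero t ht]
    · have := hymono (mem_Ici.2 le_rfl) (mem_Ici.2 ht) ht
      simp only [h.angle_zero 0 le_rfl, zero_mul] at this
      exact nonneg_of_mul_nonneg_left this (Real.exp_pos _)
  obtain ⟨t₁, ht₁, hne⟩ := hne
  have hpos₁ : 0 < θ t₁ := lt_of_le_of_ne (hnonneg t₁) hne.symm
  have hpos : ∀ t ≥ t₁, 0 < θ t := by
    intro t ht
    have := hymono (mem_Ici.2 ht₁.le) (mem_Ici.2 (ht₁.le.trans ht)) ht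
    exact pos_of_mul_pos_left ((mul_pos hpos₁ (Real.exp_pos _)).trans_le this) (Real.exp_pos _).le
  -- If `θ` stayed below `π / 2`, it would increase from `t₁` on, at a rate at least `-k * sin (θ
  -- t₁) > 0`, and would pass `π / 2` after finite time.
  have hreach : ∃ t ≥ 0, Real.pi / 2 ≤ θ t := by
    by_contra! hlt
    have hlow : ∀ t ≥ t₁, -k * Real.sin (θ t)
        ≤ c * F t (q t) * Real.cos (θ t) ^ 2 - k * Real.sin (θ t) := fun t ht => by
      have := mul_nonneg (hF t (ht₁.le.trans ht)) (sq_nonneg (Real.cos (θ t)))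
      linarith
    have hsin : ∀ t ≥ t₁, 0 < Real.sin (θ t) := fun t ht =>
      Real.sin_pos_of_pos_of_lt_pi (hpos t ht) (by linarith [hlt t (ht₁.le.trans ht)])
    have hθmono : MonotoneOn θ (Ici t₁) :=
      monotoneOn_of_hasDerivWithinAt_nonneg (convex_Ici t₁) hc.continuousOn
        (fun t _ => (h.angle t).hasDerivWithinAt) (fun t ht => by
          have ht' := mem_Ici.1 (interior_subset ht)
          exact (mul_nonneg (by linarith) (hsin t ht').le).trans (hlow t ht'))
    set r := -k * Real.sin (θ t₁) with hr
    have hr0 : 0 < r := mul_pos (by linarith) (hsin t₁ le_rfl)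
    have hgrow : ∀ t ≥ t₁, r * (t - t₁) ≤ θ t - θ t₁ := fun t ht =>
      (convex_Ici t₁).mul_sub_le_image_sub_of_le_deriv hc.continuousOn
        (fun s _ => (h.angle s).differentiableAt.differentiableWithinAt) (fun s hs => by
          have hs' := mem_Ici.1 (interior_subset hs)
          rw [(h.angle s).deriv]
          refine le_trans ?_ (hlow s hs')
          refine mul_le_mul_of_nonneg_left ?_ (by linarith)
          exact Real.sin_le_sin_of_le_of_le_pi_div_two (by linarith)
            (hlt s (ht₁.le.trans hs')).le (hθmono (mem_Ici.2 le_rfl) hs' hs'))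
        t₁ (mem_Ici.2 le_rfl) t ht ht
    have h1 := hgrow (t₁ + Real.pi / 2 / r) (by
      have : 0 < Real.pi / 2 / r := by positivity
      linarith)
    rw [add_sub_cancel_left, mul_div_cancel₀ _ hr0.ne'] at h1
    have h2 := hlt (t₁ + Real.pi / 2 / r) (by
      have : 0 < Real.pi / 2 / r := by positivity
      linarith)
    linarith
  -- The required time is the first hitting time of `π / 2`.
  set S : Set ℝ := {t | 0 ≤ t ∧ Real.pi / 2 ≤ θ t} with hS
  have hSc : IsClosed S := (isClosed_le continuous_const continuous_id).inter
    (isClosed_le continuous_const hc)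
  have hSb : BddBelow S := ⟨0, fun t ht => ht.1⟩
  have hT := hSc.csInf_mem hreach hSb
  set T := sInf S with hTdef
  have hT0 : 0 < T := by
    refine lt_of_le_of_ne hT.1 fun h0 => ?_
    have := hT.2
    rw [← h0, h.angle_zero 0 le_rfl] at this
    linarith
  have hltT : ∀ t < T, θ t < Real.pi / 2 := by
    intro t ht
    rcases le_total t 0 with h0 | h0
    · rw [h.angle_zero t h0]
      linarith
    · by_contra! hge
      exact absurd (csInf_le hSb (show t ∈ S from ⟨h0, hge⟩)) (not_le.2 ht)
  refine ⟨T, hT0, le_antisymm ?_ hT.2, fun t ht => ⟨hnonneg t, hltT t ht⟩⟩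
  have hcl : T ∈ closure (Iio T) := by
    rw [closure_Iio]
    exact mem_Iic.2 le_rfl
  exact closure_minimal (fun t ht => (hltT t ht).le) (isClosed_le hc continuous_const) hcl

end IsDrivenMotion

/-! ### Radiation data and the waves they generate. -/

/-- Space derivative of the left-moving part of the radiation field. -/
def leftSlope (V₀ V₁ : ℝ → ℝ) (η : ℝ) : ℝ := (deriv V₀ η + V₁ η) / 2

/-- Space derivative of the right-moving part of the radiation field. -/
def rightSlope (V₀ V₁ : ℝ → ℝ) (η : ℝ) : ℝ := (deriv V₀ η - V₁ η) / 2

/-- Left-moving part of the radiation field, as a function of `t + s`. -/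
def leftWave (V₀ V₁ : ℝ → ℝ) (η : ℝ) : ℝ := (V₀ η + ∫ r in (0 : ℝ)..η, V₁ r) / 2

/-- Right-moving part of the radiation field, as a function of `t - s`. -/
def rightWave (V₀ V₁ : ℝ → ℝ) (ξ : ℝ) : ℝ := (V₀ (-ξ) - ∫ r in (0 : ℝ)..(-ξ), V₁ r) / 2

/-- Space derivative of the radiation field at the particle position; its value is frozen for
negative times. -/
def radiationDrive (V₀ V₁ : ℝ → ℝ) (t q : ℝ) : ℝ :=
  leftSlope V₀ V₁ (q + max t 0) + rightSlope V₀ V₁ (q - max t 0)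

theorem abs_sub_le_of_hasDerivAt {g g' : ℝ → ℝ} {C : ℝ} (hg : ∀ ξ, HasDerivAt g (g' ξ) ξ)
    (hC : ∀ ξ, |g' ξ| ≤ C) (ξ ξ' : ℝ) : |g ξ - g ξ'| ≤ C * |ξ - ξ'| :=
  convex_univ.norm_image_sub_le_of_norm_hasDerivWithin_le
    (fun η _ => (hg η).hasDerivWithinAt) (fun η _ => hC η) (mem_univ ξ') (mem_univ ξ)

section Radiation

variable {V₀ V₁ : ℝ → ℝ}

theorem IsRadiationDatum.deriv {V : ℝ → ℝ} (h : IsRadiationDatum V) :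
    IsRadiationDatum (deriv V) where
  smooth := (contDiff_infty_iff_deriv.1 h.smooth).2
  compact_support := h.compact_support.deriv
  away_from_origin h' := h.away_from_origin (tsupport_deriv_subset h')

theorem IsRadiationDatum.map_zero {V : ℝ → ℝ} (h : IsRadiationDatum V) : V 0 = 0 :=
  image_eq_zero_of_notMem_tsupport h.away_from_origin

theorem IsRadiationDatum.exists_bounds {V : ℝ → ℝ} (h : IsRadiationDatum V) :
    ∃ C, 0 ≤ C ∧ (∀ η, |V η| ≤ C) ∧ (∀ η η', |V η - V η'| ≤ C * |η - η'|) ∧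
      ∀ η, C < |η| → V η = 0 := by
  obtain ⟨K, hK⟩ := h.smooth.lipschitzWith_of_hasCompactSupport h.compact_support (by simp)
  obtain ⟨M, hM⟩ := h.compact_support.exists_bound_of_continuous h.smooth.continuous
  obtain ⟨B, hB⟩ := h.compact_support.isCompact.isBounded.subset_closedBall 0
  refine ⟨max (max K M) B, le_max_of_le_left (le_max_of_le_left K.2),
    fun η => (hM η).trans (le_max_of_le_left (le_max_right _ _)), fun η η' => ?_, fun η hη => ?_⟩
  · exact (hK.dist_le_mul η η').trans (mul_le_mul_of_nonneg_right
      (le_max_of_le_left (le_max_left _ _)) (abs_nonneg _))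
  · refine image_eq_zero_of_notMem_tsupport fun h' => ?_
    have := hB h'
    rw [Metric.mem_closedBall, dist_zero_right, Real.norm_eq_abs] at this
    exact absurd (le_max_right (max (K : ℝ) M) B) (by linarith)

theorem isRadiationDatum_leftSlope (h₀ : IsRadiationDatum V₀) (h₁ : IsRadiationDatum V₁) :
    IsRadiationDatum (leftSlope V₀ V₁) where
  smooth := (h₀.deriv.smooth.add h₁.smooth).div_const 2
  compact_support := by
    have := (h₀.deriv.compact_support.add h₁.compact_support).mul_right (f' := fun _ => (2 : ℝ)⁻¹)
    exact this
  away_from_origin h := by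
    have hsub : tsupport (leftSlope V₀ V₁) ⊆ tsupport (deriv V₀) ∪ tsupport V₁ := by
      refine closure_minimal (fun η hη => ?_) ((isClosed_tsupport _).union (isClosed_tsupport _))
      by_contra hn
      rw [mem_union, not_or] at hn
      exact hη (by simp [leftSlope, image_eq_zero_of_notMem_tsupport hn.1,
        image_eq_zero_of_notMem_tsupport hn.2])
    exact (hsub h).elim h₀.deriv.away_from_origin h₁.away_from_origin

theorem IsRadiationDatum.neg {V : ℝ → ℝ} (h : IsRadiationDatum V) :
    IsRadiationDatum (fun η => -V η) where
  smooth := h.smooth.neg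
  compact_support := h.compact_support.comp_left (g := fun r => -r) neg_zero
  away_from_origin := by
    have : tsupport (fun η => -V η) = tsupport V := by
      simp [tsupport, Function.support_fun_neg]
    rw [this]
    exact h.away_from_origin

theorem isRadiationDatum_rightSlope (h₀ : IsRadiationDatum V₀) (h₁ : IsRadiationDatum V₁) :
    IsRadiationDatum (rightSlope V₀ V₁) := by
  have : rightSlope V₀ V₁ = leftSlope V₀ fun η => -V₁ η := by
    funext η
    simp [rightSlope, leftSlope, sub_eq_add_neg]
  rw [this]
  exact isRadiationDatum_leftSlope h₀ h₁.neg

theorem hasDerivAt_leftWave (h₀ : IsRadiationDatum V₀) (h₁ : IsRadiationDatum V₁) (η : ℝ) :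
    HasDerivAt (leftWave V₀ V₁) (leftSlope V₀ V₁ η) η :=
  (((h₀.smooth.differentiable (by simp)) η).hasDerivAt.add
    (h₁.smooth.continuous.integral_hasStrictDerivAt 0 η).hasDerivAt).div_const 2

theorem hasDerivAt_rightWave (h₀ : IsRadiationDatum V₀) (h₁ : IsRadiationDatum V₁) (ξ : ℝ) :
    HasDerivAt (rightWave V₀ V₁) (-rightSlope V₀ V₁ (-ξ)) ξ := by
  have h : HasDerivAt (fun η => (V₀ η - ∫ r in (0 : ℝ)..η, V₁ r) / 2)
      (rightSlope V₀ V₁ (-ξ)) (-ξ) :=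
    (((h₀.smooth.differentiable (by simp)) (-ξ)).hasDerivAt.sub
      (h₁.smooth.continuous.integral_hasStrictDerivAt 0 (-ξ)).hasDerivAt).div_const 2
  exact (h.comp ξ (hasDerivAt_neg ξ)).congr_deriv (by ring)

theorem contDiff_one_of_hasDerivAt {g g' : ℝ → ℝ} (hg : ∀ ξ, HasDerivAt g (g' ξ) ξ)
    (hc : Continuous g') : ContDiff ℝ 1 g := by
  rw [contDiff_one_iff_deriv]
  refine ⟨fun ξ => (hg ξ).differentiableAt, ?_⟩
  rwa [show _root_.deriv g = g' from funext fun ξ => (hg ξ).deriv]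

theorem continuous_rightSlope_neg (h₀ : IsRadiationDatum V₀) (h₁ : IsRadiationDatum V₁) :
    Continuous fun ξ => -rightSlope V₀ V₁ (-ξ) :=
  ((isRadiationDatum_rightSlope h₀ h₁).smooth.continuous.comp continuous_neg).neg

theorem contDiff_leftWave (h₀ : IsRadiationDatum V₀) (h₁ : IsRadiationDatum V₁) :
    ContDiff ℝ 1 (leftWave V₀ V₁) :=
  contDiff_one_of_hasDerivAt (hasDerivAt_leftWave h₀ h₁)
    (isRadiationDatum_leftSlope h₀ h₁).smooth.continuous

theorem contDiff_rightWave (h₀ : IsRadiationDatum V₀) (h₁ : IsRadiationDatum V₁) :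
    ContDiff ℝ 1 (rightWave V₀ V₁) :=
  contDiff_one_of_hasDerivAt (hasDerivAt_rightWave h₀ h₁) (continuous_rightSlope_neg h₀ h₁)

theorem exists_lipschitz_waves (h₀ : IsRadiationDatum V₀) (h₁ : IsRadiationDatum V₁) :
    ∃ C, 0 ≤ C ∧ (∀ ξ ξ', |rightWave V₀ V₁ ξ - rightWave V₀ V₁ ξ'| ≤ C * |ξ - ξ'|) ∧
      ∀ ξ ξ', |leftWave V₀ V₁ ξ - leftWave V₀ V₁ ξ'| ≤ C * |ξ - ξ'| := by
  obtain ⟨C, hC0, hC, -⟩ := (isRadiationDatum_leftSlope h₀ h₁).exists_bounds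
  obtain ⟨D, hD0, hD, -⟩ := (isRadiationDatum_rightSlope h₀ h₁).exists_bounds
  refine ⟨C + D, by positivity, abs_sub_le_of_hasDerivAt (hasDerivAt_rightWave h₀ h₁) fun ξ => ?_,
    abs_sub_le_of_hasDerivAt (hasDerivAt_leftWave h₀ h₁) fun ξ => ?_⟩
  · rw [abs_neg]
    linarith [hD (-ξ)]
  · linarith [hC ξ]

/-- Existence of the motion driven by smooth radiation data. -/
theorem exists_isDrivenMotion_radiationDrive (h₀ : IsRadiationDatum V₀)
    (h₁ : IsRadiationDatum V₁) (c k : ℝ) : ∃ M, (∀ t q, |radiationDrive V₀ V₁ t q| ≤ M) ∧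
      ∃ θ q, IsDrivenMotion c k (radiationDrive V₀ V₁) θ q := by
  have hl := isRadiationDatum_leftSlope h₀ h₁
  have hr := isRadiationDatum_rightSlope h₀ h₁
  obtain ⟨C, hC0, hC, hCl, -⟩ := hl.exists_bounds
  obtain ⟨D, hD0, hD, hDl, -⟩ := hr.exists_bounds
  have hM : ∀ t q, |radiationDrive V₀ V₁ t q| ≤ C + D := fun t q =>
    (abs_add_le _ _).trans (add_le_add (hC _) (hD _))
  refine ⟨C + D, hM, exists_isDrivenMotion c k (K := C + D) (by positivity) (fun t q q' => ?_)
    hM (fun q => ?_) fun t ht => ?_⟩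
  · have e1 := hCl (q + max t 0) (q' + max t 0)
    have e2 := hDl (q - max t 0) (q' - max t 0)
    rw [add_sub_add_right_eq_sub] at e1
    rw [sub_sub_sub_cancel_right] at e2
    have : radiationDrive V₀ V₁ t q - radiationDrive V₀ V₁ t q'
        = (leftSlope V₀ V₁ (q + max t 0) - leftSlope V₀ V₁ (q' + max t 0))
        + (rightSlope V₀ V₁ (q - max t 0) - rightSlope V₀ V₁ (q' - max t 0)) := by
      simp only [radiationDrive]; ring
    rw [this, add_mul]
    exact (abs_add_le _ _).trans (add_le_add e1 e2)
  · have := hl.smooth.continuous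
    have := hr.smooth.continuous
    unfold radiationDrive
    fun_prop
  -- This is where data vanishing at the origin are needed: the particle can rest there at all
  -- negative times.
  · simp [radiationDrive, max_eq_right ht, hl.map_zero, hr.map_zero]

end Radiation

/-! ### From the angle equation to a joint solution. -/

/-- The two retarded times agree at `0` and both have derivative `1` there, because the particle
starts at rest; hence so does their minimum. This handles the initial field velocity at the particle
itself. -/
theorem hasDerivAt_min_retardedTime_zero {I : Set ℝ} {q v : ℝ → ℝ} (h : IsWorldline I q v) :
    HasDerivAt (fun t => min (retardedTime q t) (retardedTime (fun t => -q t) t)) 1 0 := by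
  have h0 : retardedTime q 0 = 0 := h.retardedTime_of_nonpos le_rfl
  have h0' : retardedTime (fun t => -q t) 0 = 0 := h.neg.retardedTime_of_nonpos le_rfl
  have h1 : HasDerivAt (retardedTime q) 1 0 := by
    have := h.hasDerivAt_retardedTime (ξ := 0) (by rw [h0]; exact h.zero_mem)
    simpa [h0, h.velocity_eq_zero le_rfl] using this
  have h2 : HasDerivAt (retardedTime fun t => -q t) 1 0 := by
    have := h.neg.hasDerivAt_retardedTime (ξ := 0) (by rw [h0']; exact h.zero_mem)
    simpa [h0', h.velocity_eq_zero le_rfl] using this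
  rw [hasDerivAt_iff_isLittleO] at h1 h2 ⊢
  have hs := h1.norm_left.add h2.norm_left
  refine Asymptotics.IsBigO.trans_isLittleO (Asymptotics.IsBigO.of_bound 1 ?_) hs
  refine Filter.Eventually.of_forall fun t => ?_
  simp only [h0, h0', min_self, sub_zero, smul_eq_mul, mul_one, one_mul, Real.norm_eq_abs]
  refine le_trans ?_ (le_abs_self _)
  rcases min_choice (retardedTime q t) (retardedTime (fun t => -q t) t) with hc | hc <;> rw [hc]
  · exact le_add_of_nonneg_right (abs_nonneg _)
  · exact le_add_of_nonneg_left (abs_nonneg _)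

/-- With `p = m * tan θ` the square root is `1 / cos θ` and the factor `m` cancels, whatever its
sign. -/
theorem momentum_relation {m θ : ℝ} (hm : m ≠ 0) (hθ : 0 < Real.cos θ) :
    m * Real.tan θ / (m * √(1 + (m * Real.tan θ) ^ 2 / m ^ 2)) = Real.sin θ := by
  have h1 : 1 + (m * Real.tan θ) ^ 2 / m ^ 2 = (Real.cos θ)⁻¹ ^ 2 := by
    rw [Real.tan_eq_sin_div_cos]
    field_simp
    linarith [Real.sin_sq_add_cos_sq θ]
  rw [h1, Real.sqrt_sq (inv_pos.2 hθ).le, Real.tan_eq_sin_div_cos]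
  field_simp

theorem isJointSolution_jointField {a m : ℝ} (hm : m ≠ 0) {V₀ V₁ : ℝ → ℝ}
    (h₀ : IsRadiationDatum V₀) (h₁ : IsRadiationDatum V₁) {I J : Set ℝ} {q v θ : ℝ → ℝ}
    (h : IsWorldline I q v) (hJI : J ⊆ I) (hJ0 : J ⊆ Ici 0) (hv : ∀ t ∈ J, v t = Real.sin (θ t))
    (hcos : ∀ t ∈ J, 0 < Real.cos (θ t))
    (hθ : ∀ t ∈ J, HasDerivWithinAt θ (a / m * radiationDrive V₀ V₁ t (q t) * Real.cos (θ t) ^ 2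
      - a ^ 2 / (2 * m) * Real.sin (θ t)) J t) :
    IsJointSolution a m V₀ V₁ J
      (jointField a (rightWave V₀ V₁) (leftWave V₀ V₁) q) q where
  wave := h.isSourcedWave_jointField (interior_subset.trans hJI) a
    (contDiff_rightWave h₀ h₁).continuous (contDiff_leftWave h₀ h₁).continuous
  field_initial s := by
    simp only [jointField, zero_sub, zero_add, sub_zero, rightWave, leftWave, neg_neg]
    have : min (retardedTime q (-s)) (retardedTime (fun t => -q t) s) = -|s| := by
      rcases le_total 0 s with hs | hs
      · have := h.min_retardedTime_of_le (t := 0) (s := s) (by rw [h.eq_zero 0 le_rfl]; exact hs)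
        rw [zero_sub, zero_add] at this
        rw [this, h.retardedTime_of_nonpos (neg_nonpos.2 hs), abs_of_nonneg hs]
      · have := h.min_retardedTime_of_ge (t := 0) (s := s) (by rw [h.eq_zero 0 le_rfl]; exact hs)
        rw [zero_sub, zero_add] at this
        rw [this, h.neg.retardedTime_of_nonpos hs, abs_of_nonpos hs, neg_neg]
    rw [this]
    ring
  field_velocity_initial s := by
    refine HasDerivAt.hasDerivWithinAt ?_
    have hx := hasDerivAt_rightWave h₀ h₁
    have hy := hasDerivAt_leftWave h₀ h₁
    have hI : ∀ t < (0 : ℝ), t ∈ I := fun t ht => h.mem_of_le 0 h.zero_mem t ht.le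
    have hq0 := h.eq_zero 0 le_rfl
    by_cases hs : s = 0
    · subst hs
      have hrad := (hx 0).add (hy 0)
      have := hrad.add (((hasDerivAt_min_retardedTime_zero h).sub
        (hasDerivAt_id (0 : ℝ))).const_mul (a / 2))
      have e : (fun t => jointField a (rightWave V₀ V₁) (leftWave V₀ V₁) q (t, 0)) = fun t =>
          rightWave V₀ V₁ t + leftWave V₀ V₁ t
          + a / 2 * (min (retardedTime q t) (retardedTime (fun t => -q t) t) - t) := by
        funext t
        simp [jointField]
      rw [e]
      refine this.congr_deriv ?_
      simp only [neg_zero, leftSlope, rightSlope]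
      ring
    · have hd := (h.contDiffAt_jointField a (contDiff_rightWave h₀ h₁) (contDiff_leftWave h₀ h₁)
        (z := (0, s)) (by simpa [hq0] using hs) hI).differentiableAt (by simp)
      have hdt := hasDerivAt_time hd
      have hval : partialTime (jointField a (rightWave V₀ V₁) (leftWave V₀ V₁) q) (0, s)
          = V₁ s := by
        rcases lt_or_gt_of_ne hs with hlt | hlt
        · rw [(h.partial_jointField_left a hx hy (z := (0, s)) (by simpa [hq0] using hlt) hI).1]
          simp only [zero_sub, zero_add, neg_neg]
          rw [h.neg.retardedTime_of_nonpos hlt.le, h.velocity_eq_zero hlt.le]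
          simp only [leftSlope, rightSlope]
          ring
        · rw [(h.partial_jointField_right a hx hy (z := (0, s)) (by simpa [hq0] using hlt) hI).1]
          simp only [zero_sub, zero_add, neg_neg]
          rw [h.retardedTime_of_nonpos (neg_nonpos.2 hlt.le),
            h.velocity_eq_zero (neg_nonpos.2 hlt.le)]
          simp only [leftSlope, rightSlope]
          ring
      rw [← hval]
      exact hdt.congr_deriv hdt.deriv.symm
  motion := by
    obtain ⟨C, -, hxC, hyC⟩ := exists_lipschitz_waves h₀ h₁
    have hl := (isRadiationDatum_leftSlope h₀ h₁).smooth.continuous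
    have hr := (isRadiationDatum_rightSlope h₀ h₁).smooth.continuous
    have hq := h.continuous
    have hvc := h.continuous_velocity
    have hvne : ∀ t ∈ J, 1 - v t ^ 2 ≠ 0 := fun t ht => by
      have := (sq_lt_one_iff_abs_lt_one _).2 (h.subluminal t (hJI ht))
      linarith
    refine ⟨fun t => m * Real.tan (θ t), fun t => a * (leftSlope V₀ V₁ (t + q t)
      - -rightSlope V₀ V₁ (-(t - q t))) - a ^ 2 / 2 * (v t / (1 - v t ^ 2)), ?_, ?_, ?_⟩
    · refine h.isKiesslingForce_jointField (interior_subset.trans hJI) a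
        (hasDerivAt_rightWave h₀ h₁) (hasDerivAt_leftWave h₀ h₁)
        (continuous_rightSlope_neg h₀ h₁) hl hxC hyC ?_ fun t _ => rfl
      refine ContinuousOn.sub (Continuous.continuousOn (by fun_prop)) ?_
      exact continuousOn_const.mul (hvc.continuousOn.div
        (Continuous.continuousOn (by fun_prop)) hvne)
    · intro t ht
      rw [momentum_relation hm (hcos t ht), ← hv t ht]
      exact (h.hasDerivAt t (hJI ht)).hasDerivWithinAt
    · intro t ht
      have hc := hcos t ht
      refine (((Real.hasDerivAt_tan hc.ne').comp_hasDerivWithinAt t (hθ t ht)).const_mul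
        m).congr_deriv ?_
      have hn := hvne t ht
      beta_reduce
      rw [hv t ht] at hn ⊢
      have hcs : 1 - Real.sin (θ t) ^ 2 = Real.cos (θ t) ^ 2 := by
        linarith [Real.sin_sq_add_cos_sq (θ t)]
      have hdr : radiationDrive V₀ V₁ t (q t)
          = leftSlope V₀ V₁ (t + q t) + rightSlope V₀ V₁ (-(t - q t)) := by
        rw [radiationDrive, max_eq_left (hJ0 ht), add_comm (q t), neg_sub]
      rw [hcs, hdr]
      field_simp
      ring
  position_initial := h.eq_zero 0 le_rfl
  velocity_initial := by
    have := h.hasDerivAt 0 h.zero_mem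
    rw [h.velocity_eq_zero le_rfl] at this
    exact this.hasDerivWithinAt

theorem IsWorldline.lipschitzOnWith_jointField {I : Set ℝ} {q v : ℝ → ℝ} (h : IsWorldline I q v)
    (a : ℝ) {x y : ℝ → ℝ} {C : ℝ} (hC : 0 ≤ C) (hx : ∀ ξ ξ', |x ξ - x ξ'| ≤ C * |ξ - ξ'|)
    (hy : ∀ ξ ξ', |y ξ - y ξ'| ≤ C * |ξ - ξ'|) {κ : ℝ} (hκ1 : κ < 1) {S : Set ℝ} (hS : S ⊆ I)
    (hκ : ∀ T ∈ S, ∀ t ≤ T, |v t| ≤ κ) :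
    ∃ K, LipschitzOnWith K (jointField a x y q) (S ×ˢ univ) := by
  have hk : 0 ≤ (1 - κ)⁻¹ := inv_nonneg.2 (by linarith)
  refine ⟨(4 * C + |a| / 2 * (2 * (1 - κ)⁻¹ + 1)).toNNReal,
    LipschitzOnWith.of_dist_le_mul fun z hz w hw => ?_⟩
  rw [Real.coe_toNNReal _ (by positivity), Real.dist_eq]
  rcases le_total z.1 w.1 with hle | hle
  · exact h.abs_jointField_sub_le a hx hy (hS hw.1) hκ1 (hκ _ hw.1) hle le_rfl
  · exact h.abs_jointField_sub_le a hx hy (hS hz.1) hκ1 (hκ _ hz.1) le_rfl hle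

/-! ### Driven motions as worldlines. -/

namespace IsDrivenMotion

variable {c k : ℝ} {F : ℝ → ℝ → ℝ} {θ q : ℝ → ℝ}

theorem abs_sin_le_sin {b θ : ℝ} (hb : b ≤ Real.pi / 2) (h : |θ| ≤ b) :
    |Real.sin θ| ≤ Real.sin b := by
  obtain ⟨h1, h2⟩ := abs_le.1 h
  refine abs_le.2 ⟨?_, Real.sin_le_sin_of_le_of_le_pi_div_two (by linarith) hb h2⟩
  have := Real.sin_le_sin_of_le_of_le_pi_div_two (x := -θ) (by linarith) hb (by linarith)
  rw [Real.sin_neg] at this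
  linarith

theorem sin_lt_one {b : ℝ} (hb0 : 0 ≤ b) (hb : b < Real.pi / 2) : Real.sin b < 1 := by
  rw [← Real.sin_pi_div_two]
  exact Real.sin_lt_sin_of_lt_of_le_pi_div_two (by linarith [Real.pi_pos]) le_rfl hb

theorem abs_position_le (h : IsDrivenMotion c k F θ q) {κ : ℝ} (hκ : ∀ t, |Real.sin (θ t)| ≤ κ)
    (t : ℝ) : |q t| ≤ κ * |t| := by
  have := abs_sub_le_of_hasDerivAt h.position hκ t 0
  rwa [h.position_zero 0 le_rfl, sub_zero, sub_zero] at this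

/-- A motion with uniformly subluminal velocity is a worldline for all times. -/
theorem isWorldline_univ (h : IsDrivenMotion c k F θ q) {κ : ℝ} (hκ1 : κ < 1)
    (hκ : ∀ t, |Real.sin (θ t)| ≤ κ) : IsWorldline univ q fun t => Real.sin (θ t) where
  isOpen := isOpen_univ
  mem_of_le _ _ _ _ := mem_univ _
  zero_mem := mem_univ _
  hasDerivAt t _ := h.position t
  continuous_velocity := Real.continuous_sin.comp h.continuous_angle
  subluminal t _ := (hκ t).trans_lt hκ1
  continuous := h.continuous_position
  eq_zero := h.position_zero
  strictMono_sub := strictMono_of_hasDerivAt_pos (f' := fun t => 1 - Real.sin (θ t))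
    (fun t => (hasDerivAt_id t).sub (h.position t))
    (fun t => by linarith [(abs_le.1 (hκ t)).2])
  strictMono_add := strictMono_of_hasDerivAt_pos (f' := fun t => 1 + Real.sin (θ t))
    (fun t => (hasDerivAt_id t).add (h.position t))
    (fun t => by linarith [(abs_le.1 (hκ t)).1])
  tendsto_sub := by
    refine Filter.tendsto_atTop_mono' _ ?_
      (Filter.tendsto_id.const_mul_atTop (show 0 < 1 - κ by linarith))
    filter_upwards [Filter.eventually_ge_atTop (0 : ℝ)] with t ht
    have := h.abs_position_le hκ t
    rw [abs_of_nonneg ht] at this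
    simp only [id]
    linarith [(abs_le.1 this).2]
  tendsto_add := by
    refine Filter.tendsto_atTop_mono' _ ?_
      (Filter.tendsto_id.const_mul_atTop (show 0 < 1 - κ by linarith))
    filter_upwards [Filter.eventually_ge_atTop (0 : ℝ)] with t ht
    have := h.abs_position_le hκ t
    rw [abs_of_nonneg ht] at this
    simp only [id]
    linarith [(abs_le.1 this).1]

/-- Write the map as `(t - min t T) + (min t T + g (min t T))`: both parts are nondecreasing, and
one of them is strictly increasing on each side of `T`. -/
theorem strictMono_frozen {g : ℝ → ℝ} {T : ℝ} (hg : StrictMonoOn (fun t => t + g t) (Iic T)) :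
    StrictMono fun t => t + g (min t T) := by
  intro t t' hlt
  have hmin : min t T ≤ min t' T := min_le_min_right T hlt.le
  rcases hmin.eq_or_lt with heq | hlt'
  · simp only [heq]
    linarith
  · have h1 := hg (mem_Iic.2 (min_le_right t T)) (mem_Iic.2 (min_le_right t' T)) hlt'
    have h2 : t - min t T ≤ t' - min t' T := by
      rcases le_total t T with h | h
      · rw [min_eq_left h, sub_self]
        linarith [min_le_left t' T]
      · rw [min_eq_right h, min_eq_right (h.trans hlt.le)]
        linarith
    simp only at h1 ⊢
    linarith

theorem tendsto_frozen (g : ℝ → ℝ) (T : ℝ) :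
    Filter.Tendsto (fun t => t + g (min t T)) Filter.atTop Filter.atTop := by
  refine (Filter.tendsto_atTop_add_const_right _ (g T) Filter.tendsto_id).congr' ?_
  filter_upwards [Filter.eventually_ge_atTop T] with t ht
  rw [min_eq_right ht, id]

/-- A motion which is subluminal before time `T` and frozen afterwards is a worldline. -/
theorem isWorldline_Iio (h : IsDrivenMotion c k F θ q) {T : ℝ} (hT : 0 < T)
    (hsub : ∀ t < T, |Real.sin (θ t)| < 1) :
    IsWorldline (Iio T) (fun t => q (min t T)) fun t => Real.sin (θ (min t T)) where
  isOpen := isOpen_Iio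
  mem_of_le _ ht _ hle := lt_of_le_of_lt hle ht
  zero_mem := hT
  hasDerivAt t ht := by
    rw [min_eq_left (le_of_lt ht)]
    refine (h.position t).congr_of_eventuallyEq ?_
    filter_upwards [Iio_mem_nhds ht] with t' ht'
    rw [min_eq_left (le_of_lt ht')]
  continuous_velocity := Real.continuous_sin.comp
    (h.continuous_angle.comp (continuous_id.min continuous_const))
  subluminal t ht := by
    rw [min_eq_left (le_of_lt ht)]
    exact hsub t ht
  continuous := h.continuous_position.comp (continuous_id.min continuous_const)
  eq_zero t ht := h.position_zero _ ((min_le_left _ _).trans ht)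
  strictMono_sub := by
    simp only [sub_eq_add_neg]
    refine strictMono_frozen (g := fun t => -q t) ?_
    refine strictMonoOn_of_hasDerivWithinAt_pos (f' := fun t => 1 + -Real.sin (θ t))
      (convex_Iic T) (continuous_id.add h.continuous_position.neg).continuousOn
      (fun t _ => ((hasDerivAt_id t).add (h.position t).neg).hasDerivWithinAt) fun t ht => ?_
    rw [interior_Iic] at ht
    linarith [(abs_lt.1 (hsub t ht)).2]
  strictMono_add := by
    refine strictMono_frozen ?_
    refine strictMonoOn_of_hasDerivWithinAt_pos (f' := fun t => 1 + Real.sin (θ t))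
      (convex_Iic T) (continuous_id.add h.continuous_position).continuousOn
      (fun t _ => ((hasDerivAt_id t).add (h.position t)).hasDerivWithinAt) fun t ht => ?_
    rw [interior_Iic] at ht
    linarith [(abs_lt.1 (hsub t ht)).1]
  tendsto_sub := by
    simp only [sub_eq_add_neg]
    exact tendsto_frozen (fun t => -q t) T
  tendsto_add := tendsto_frozen q T

theorem angle_eq_zero (h : IsDrivenMotion 0 0 F θ q) (t : ℝ) : θ t = 0 := by
  rw [← h.angle_zero 0 le_rfl]
  refine is_const_of_deriv_eq_zero (fun t => (h.angle t).differentiableAt) (fun t => ?_) t 0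
  rw [(h.angle t).deriv]
  ring

end IsDrivenMotion

/-! ### Positive bare mass. -/

/-- For positive bare mass the motion is uniformly subluminal, and the velocity tends to `0`. -/
theorem exists_angle_bound_and_tendsto {a m : ℝ} (hm : 0 < m) {V₀ V₁ : ℝ → ℝ}
    (h₀ : IsRadiationDatum V₀) (h₁ : IsRadiationDatum V₁) {θ q : ℝ → ℝ} {M : ℝ}
    (hM : ∀ t s, |radiationDrive V₀ V₁ t s| ≤ M)
    (h : IsDrivenMotion (a / m) (a ^ 2 / (2 * m)) (radiationDrive V₀ V₁) θ q) :
    ∃ b, 0 ≤ b ∧ b < Real.pi / 2 ∧ (∀ t, |θ t| ≤ b) ∧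
      Filter.Tendsto θ Filter.atTop (nhds 0) := by
  -- Without charge there is no damping, but no drive either, and the particle stays at rest.
  rcases eq_or_ne a 0 with rfl | ha
  · have hθ : ∀ t, θ t = 0 := by
      simp only [zero_div, ne_eq, OfNat.ofNat_ne_zero, not_false_eq_true, zero_pow] at h
      exact h.angle_eq_zero
    refine ⟨0, le_rfl, by linarith [Real.pi_pos], fun t => by rw [hθ t, abs_zero], ?_⟩
    rw [funext hθ]
    exact tendsto_const_nhds
  · have hk : 0 < a ^ 2 / (2 * m) := by positivity
    obtain ⟨b, hb0, hb, hθ⟩ := h.exists_abs_angle_le hM hk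
    have hκ1 := IsDrivenMotion.sin_lt_one hb0 hb
    set κ := Real.sin b
    have hκ : ∀ t, |Real.sin (θ t)| ≤ κ := fun t =>
      IsDrivenMotion.abs_sin_le_sin hb.le (hθ t)
    obtain ⟨B, hB0, -, -, hB⟩ := (isRadiationDatum_leftSlope h₀ h₁).exists_bounds
    obtain ⟨D, hD0, -, -, hD⟩ := (isRadiationDatum_rightSlope h₀ h₁).exists_bounds
    -- Since `|q t| ≤ κ * t`, both `|q t + t|` and `|q t - t|` are at least `(1 - κ) * t`. From this
    -- time on that exceeds the support radii `B` and `D` of both slopes, so the drive is zero.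
    refine ⟨b, hb0, hb, hθ, h.tendsto_angle hk (T := (B + D + 1) / (1 - κ)) (fun t ht => ?_)
      fun t => (hθ t).trans hb.le⟩
    have hκ0 : 0 < 1 - κ := by linarith
    have ht1 : B + D + 1 ≤ (1 - κ) * t := by
      rw [ge_iff_le, div_le_iff₀ hκ0] at ht
      linarith
    have ht0 : 0 ≤ t := le_trans (by positivity) ht
    have hq := h.abs_position_le hκ t
    rw [abs_of_nonneg ht0] at hq
    obtain ⟨hq1, hq2⟩ := abs_le.1 hq
    rw [radiationDrive, max_eq_left ht0, hB, hD, add_zero]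
    · rw [abs_of_nonpos (by linarith)]
      linarith
    · rw [abs_of_nonneg (by linarith)]
      linarith

theorem exists_global_jointSolution (a : ℝ) {m : ℝ} (hm : 0 < m) {V₀ V₁ : ℝ → ℝ}
    (h₀ : IsRadiationDatum V₀) (h₁ : IsRadiationDatum V₁) :
    ∃ (u : ℝ × ℝ → ℝ) (q : ℝ → ℝ),
      IsJointSolution a m V₀ V₁ (Ici 0) u q ∧
      (∃ K, LipschitzOnWith K u (Ici 0 ×ˢ univ)) ∧
      ContDiffOn ℝ 1 q (Ici 0) ∧
      ContDiffOn ℝ 1 u {z | z.1 ∈ Ici 0 ∧ z.2 ≠ q z.1} ∧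
      ∀ ε > 0, ∃ T > 0, ∀ t > T, |derivWithin q (Ici 0) t| < ε := by
  obtain ⟨M, hM, θ, q, h⟩ := exists_isDrivenMotion_radiationDrive h₀ h₁ (a / m) (a ^ 2 / (2 * m))
  obtain ⟨b, hb0, hb, hθ, hlim⟩ := exists_angle_bound_and_tendsto hm h₀ h₁ hM h
  have hκ1 := IsDrivenMotion.sin_lt_one hb0 hb
  have hκ : ∀ t, |Real.sin (θ t)| ≤ Real.sin b := fun t =>
    IsDrivenMotion.abs_sin_le_sin hb.le (hθ t)
  have hw := h.isWorldline_univ hκ1 hκ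
  obtain ⟨C, hC, hxC, hyC⟩ := exists_lipschitz_waves h₀ h₁
  refine ⟨jointField a (rightWave V₀ V₁) (leftWave V₀ V₁) q, q, ?_, ?_, ?_, ?_, ?_⟩
  · refine isJointSolution_jointField hm.ne' h₀ h₁ hw (subset_univ _) le_rfl (fun _ _ => rfl)
      (fun t _ => ?_) fun t _ => (h.angle t).hasDerivWithinAt
    obtain ⟨h1, h2⟩ := abs_le.1 (hθ t)
    exact Real.cos_pos_of_mem_Ioo ⟨by linarith, by linarith⟩
  · exact hw.lipschitzOnWith_jointField a hC hxC hyC hκ1 (subset_univ _) fun _ _ t _ => hκ t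
  · exact h.contDiff_position.contDiffOn
  · exact fun z hz => (hw.contDiffAt_jointField a (contDiff_rightWave h₀ h₁)
      (contDiff_leftWave h₀ h₁) hz.2 fun _ _ => mem_univ _).contDiffWithinAt
  · intro ε hε
    obtain ⟨T, hT⟩ := Filter.eventually_atTop.1 ((Metric.tendsto_nhds.1 hlim) ε hε)
    refine ⟨max T 1, lt_max_of_lt_right one_pos, fun t ht => ?_⟩
    have ht0 : 0 < t := one_pos.trans ((le_max_right T 1).trans_lt ht)
    rw [(h.position t).hasDerivWithinAt.derivWithin (uniqueDiffOn_Ici 0 t ht0.le)]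
    have := hT t ((le_max_left T 1).trans ht.le)
    rw [Real.dist_eq, sub_zero] at this
    exact Real.abs_sin_le_abs.trans_lt this

/-! ### Negative bare mass. -/

/-- A small velocity pulse, supported near `s = 2`. -/
def pulse (r : ℝ) (s : ℝ) : ℝ :=
  r * (⟨1 / 2, 1, by norm_num, by norm_num⟩ : ContDiffBump (2 : ℝ)) s

theorem isRadiationDatum_zero : IsRadiationDatum fun _ => 0 where
  smooth := contDiff_const
  compact_support := HasCompactSupport.zero
  away_from_origin := by simp [tsupport]

theorem pulse_eq_zero (r : ℝ) {s : ℝ} (hs : s ≤ 1) : pulse r s = 0 := by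
  rw [pulse, ContDiffBump.zero_of_le_dist, mul_zero]
  rw [Real.dist_eq, abs_of_nonpos (by linarith)]
  linarith

theorem pulse_two (r : ℝ) : pulse r 2 = r := by
  rw [pulse, ContDiffBump.one_of_mem_closedBall, mul_one]
  exact Metric.mem_closedBall_self (by norm_num)

theorem abs_pulse_le (r s : ℝ) : |pulse r s| ≤ |r| := by
  rw [pulse, abs_mul, abs_of_nonneg (ContDiffBump.nonneg _)]
  exact mul_le_of_le_one_right (abs_nonneg _) (ContDiffBump.le_one _)

theorem mul_pulse_nonneg {c r : ℝ} (hcr : 0 ≤ c * r) (s : ℝ) : 0 ≤ c * pulse r s := by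
  rw [pulse, ← mul_assoc]
  exact mul_nonneg hcr (ContDiffBump.nonneg _)

theorem isRadiationDatum_pulse (r : ℝ) : IsRadiationDatum (pulse r) where
  smooth := contDiff_const.mul (ContDiffBump.contDiff _)
  compact_support := (ContDiffBump.hasCompactSupport _).mul_left
  away_from_origin h := by
    have hsub : tsupport (pulse r) ⊆ Ici 1 := by
      refine closure_minimal (fun s hs => ?_) isClosed_Ici
      by_contra hn
      exact hs (pulse_eq_zero r (le_of_not_ge hn))
    exact absurd (mem_Ici.1 (hsub h)) (by norm_num)

theorem normC1_zero : normC1 (fun _ => 0) = 0 := by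
  simp [normC1, normC0]

theorem normC0_pulse_le (r : ℝ) : normC0 (pulse r) ≤ ENNReal.ofReal |r| := by
  refine iSup_le fun s => ?_
  rw [Real.enorm_eq_ofReal_abs]
  exact ENNReal.ofReal_le_ofReal (abs_pulse_le r s)

/-- The right-moving slope is evaluated at `q - t ≤ 0`, where the pulse vanishes; the particle meets
only the left-moving half, whose sign is that of `r`. -/
theorem radiationDrive_pulse (r : ℝ) {t q : ℝ} (ht : 0 ≤ t) (hq : q ≤ t) :
    radiationDrive (fun _ => 0) (pulse r) t q = pulse r (q + t) / 2 := by
  rw [radiationDrive, leftSlope, rightSlope, max_eq_left ht,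
    pulse_eq_zero r (show q - t ≤ 1 by linarith)]
  simp

/-- A pulse of the right sign sets the particle in motion. -/
theorem exists_angle_ne_zero {c k r : ℝ} (hcr : 0 < c * r) {θ q : ℝ → ℝ}
    (h : IsDrivenMotion c k (radiationDrive (fun _ => 0) (pulse r)) θ q) :
    ∃ t > 0, θ t ≠ 0 := by
  by_contra! hz
  have hθ : ∀ t, θ t = 0 := fun t => by
    rcases le_or_gt t 0 with ht | ht
    exacts [h.angle_zero t ht, hz t ht]
  have hq : q 2 = 0 := by
    rw [← h.position_zero 0 le_rfl]
    refine is_const_of_deriv_eq_zero (fun t => (h.position t).differentiableAt) (fun t => ?_) 2 0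
    rw [(h.position t).deriv, hθ t, Real.sin_zero]
  -- A particle still at rest at time `2` meets the centre of the pulse, and the angle equation
  -- would force `c * r / 2 = 0`.
  have h1 := (h.angle 2).deriv
  rw [hq, radiationDrive_pulse r (by norm_num) (by norm_num), zero_add, pulse_two, funext hθ] at h1
  simp only [deriv_const', Real.cos_zero, Real.sin_zero] at h1
  linarith

theorem exists_luminal_jointSolution {a m : ℝ} (hm : m < 0) (ha : a ≠ 0) {ε : ℝ} (hε : 0 < ε) :
    ∃ V₀ V₁ : ℝ → ℝ, IsRadiationDatum V₀ ∧ IsRadiationDatum V₁ ∧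
      normC1 V₀ + normC0 V₁ < ENNReal.ofReal ε ∧
      ∃ T > 0, ∃ (u : ℝ × ℝ → ℝ) (q : ℝ → ℝ),
        IsJointSolution a m V₀ V₁ (Ico 0 T) u q ∧
        ContinuousOn u (Icc 0 T ×ˢ univ) ∧
        (∀ T' ∈ Ico 0 T, ∃ K, LipschitzOnWith K u (Icc 0 T' ×ˢ univ)) ∧
        ContDiffOn ℝ 1 q (Icc 0 T) ∧
        ContDiffOn ℝ 1 u {z | z.1 ∈ Icc 0 T ∧ z.2 ≠ q z.1} ∧
        |derivWithin q (Icc 0 T) T| = 1 := by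
  have hc : a / m ≠ 0 := div_ne_zero ha hm.ne
  -- The sign of `r` makes the drive push the angle upwards; its size makes the data small.
  obtain ⟨r, hr, hcr⟩ : ∃ r, |r| < ε ∧ 0 < a / m * r := by
    rcases lt_or_gt_of_ne hc with h | h
    · refine ⟨-(ε / 2), ?_, mul_pos_of_neg_of_neg h (by linarith)⟩
      rw [abs_neg, abs_of_pos (by linarith)]
      linarith
    · refine ⟨ε / 2, ?_, mul_pos h (by linarith)⟩
      rw [abs_of_pos (by linarith)]
      linarith
  have h₀ := isRadiationDatum_zero
  have h₁ := isRadiationDatum_pulse r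
  refine ⟨_, _, h₀, h₁, ?_, ?_⟩
  · rw [normC1_zero, zero_add]
    exact (normC0_pulse_le r).trans_lt ((ENNReal.ofReal_lt_ofReal_iff hε).2 hr)
  obtain ⟨-, -, θ, q, h⟩ := exists_isDrivenMotion_radiationDrive h₀ h₁ (a / m) (a ^ 2 / (2 * m))
  have hq : ∀ t ≥ 0, q t ≤ t := fun t ht => by
    have := h.abs_position_le (fun t => Real.abs_sin_le_one (θ t)) t
    rw [one_mul, abs_of_nonneg ht] at this
    exact (le_abs_self _).trans this
  have hk : a ^ 2 / (2 * m) < 0 := div_neg_of_pos_of_neg (by positivity) (by linarith)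
  obtain ⟨T, hT, hθT, hθ⟩ := h.exists_angle_eq_pi_div_two hk (fun t ht => by
    rw [radiationDrive_pulse r ht (hq t ht), ← mul_div_assoc]
    exact div_nonneg (mul_pulse_nonneg hcr.le _) zero_le_two) (exists_angle_ne_zero hcr h)
  have hpi := Real.pi_pos
  -- Freezing the particle after `T` keeps both null coordinates globally invertible and does not
  -- change the trajectory on `[0, T]`.
  have hw := h.isWorldline_Iio hT fun t ht => by
    have := IsDrivenMotion.abs_sin_le_sin (hθ t ht).2.le
      (abs_of_nonneg (hθ t ht).1).le
    exact this.trans_lt (IsDrivenMotion.sin_lt_one (hθ t ht).1 (hθ t ht).2)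
  have hfro : ∀ t ∈ Icc 0 T, q (min t T) = q t := fun t ht => by rw [min_eq_left ht.2]
  obtain ⟨C, hC, hxC, hyC⟩ := exists_lipschitz_waves h₀ h₁
  refine ⟨T, hT, jointField a (rightWave (fun _ => 0) (pulse r)) (leftWave (fun _ => 0) (pulse r))
    fun t => q (min t T), fun t => q (min t T), ?_, ?_, ?_, ?_, ?_, ?_⟩
  · refine isJointSolution_jointField hm.ne h₀ h₁ hw (fun t ht => ht.2) (fun t ht => ht.1)
      (θ := θ) (fun t ht => ?_) (fun t ht => ?_) fun t ht => ?_
    · rw [min_eq_left ht.2.le]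
    · obtain ⟨h1, h2⟩ := hθ t ht.2
      exact Real.cos_pos_of_mem_Ioo ⟨by linarith, h2⟩
    · rw [min_eq_left ht.2.le]
      exact (h.angle t).hasDerivWithinAt
  · exact (hw.continuous_jointField a (contDiff_rightWave h₀ h₁).continuous
      (contDiff_leftWave h₀ h₁).continuous).continuousOn
  · intro T' hT'
    obtain ⟨κ, hκ1, hκ⟩ := hw.exists_velocity_bound (show T' ∈ Iio T from hT'.2)
    exact hw.lipschitzOnWith_jointField a hC hxC hyC hκ1
      (fun t ht => lt_of_le_of_lt ht.2 hT'.2) fun s hs t ht => hκ t (ht.trans hs.2)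
  · exact h.contDiff_position.contDiffOn.congr hfro
  -- Only times before `z.1 ≤ T` must be subluminal, so the final time is included.
  · exact fun z hz => (hw.contDiffAt_jointField a (contDiff_rightWave h₀ h₁)
      (contDiff_leftWave h₀ h₁) hz.2 fun t ht => lt_of_lt_of_le ht hz.1.2).contDiffWithinAt
  · have hTm : T ∈ Icc 0 T := ⟨hT.le, le_rfl⟩
    rw [derivWithin_congr hfro (hfro T hTm),
      (h.position T).hasDerivWithinAt.derivWithin (uniqueDiffOn_Icc hT T hTm), hθT,
      Real.sin_pi_div_two, abs_one]

end

theorem theorem1 (a m : ℝ) :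
    (0 < m → ∀ V₀ V₁ : ℝ → ℝ, IsRadiationDatum V₀ → IsRadiationDatum V₁ →
      ∃ (u : ℝ × ℝ → ℝ) (q : ℝ → ℝ),
        IsJointSolution a m V₀ V₁ (Ici 0) u q ∧
        (∃ K, LipschitzOnWith K u (Ici 0 ×ˢ univ)) ∧
        ContDiffOn ℝ 1 q (Ici 0) ∧
        ContDiffOn ℝ 1 u {z | z.1 ∈ Ici 0 ∧ z.2 ≠ q z.1} ∧
        ∀ ε > 0, ∃ T > 0, ∀ t > T, |derivWithin q (Ici 0) t| < ε) ∧
    (m < 0 → a ≠ 0 → ∀ ε : ℝ, 0 < ε →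
      ∃ V₀ V₁ : ℝ → ℝ, IsRadiationDatum V₀ ∧ IsRadiationDatum V₁ ∧
        normC1 V₀ + normC0 V₁ < ENNReal.ofReal ε ∧
        ∃ T > 0, ∃ (u : ℝ × ℝ → ℝ) (q : ℝ → ℝ),
          IsJointSolution a m V₀ V₁ (Ico 0 T) u q ∧
          ContinuousOn u (Icc 0 T ×ˢ univ) ∧
          (∀ T' ∈ Ico 0 T, ∃ K, LipschitzOnWith K u (Icc 0 T' ×ˢ univ)) ∧
          ContDiffOn ℝ 1 q (Icc 0 T) ∧
          ContDiffOn ℝ 1 u {z | z.1 ∈ Icc 0 T ∧ z.2 ≠ q z.1} ∧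
          |derivWithin q (Icc 0 T) T| = 1) :=
  ⟨fun hm _ _ h₀ h₁ => exists_global_jointSolution a hm h₀ h₁,
    fun hm ha _ hε => exists_luminal_jointSolution hm ha hε⟩
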